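/- **Theorem 2.1.** Let $\Omega=(a,b)\times(c,d)$ with $a<b$, $c<d$, let $\kappa_1,\kappa_2,\gamma>0$, $1<\alpha<2$, let $v_1\le v_2$ be real numbers, and let $g,u_d\in L^2(\Omega)$ (real-valued). Put $$\mathscr K=\{q\in L^2(\Omega): v_1\le q\le v_2\ \text{a.e. in }\Omega\},\qquad J(u,q)=\tfrac12\|u-u_d\|_{L^2(\Omega)}^2+\tfrac{\gamma}{2}\|q\|_{L^2(\Omega)}^2 .$$ The Riesz derivative in $x$ is $$\frac{\partial^\alpha u}{\partial|x|^\alpha}(x,y)=\frac{-1}{2\cos(\pi\alpha/2)\,\Gamma(2-\alpha)}\,\frac{\partial^2}{\partial x^2}\Big(\int_a^x(x-\omega)^{1-\alpha}u(\omega,y)\,d\omega+\int_x^b(\omega-x)^{1-\alpha}u(\omega,y)\,d\omega\Big),$$ and $\partial^\alpha u/\partial|y|^\alpha$ is defined in the same way with respect to $y\in(c,d)$; the outer second derivatives are taken in the sense of distributions on $\Omega$. Let $H_0^{\alpha/2}(\Omega)$ be the closure of $C_0^\infty(\Omega)$ with respect to the norm $$\big(\|u\|_{L^2(\Omega)}^2+\|\,|\boldsymbol\omega|^{\alpha/2}\mathcal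 F[\tilde u]\|_{L^2(\mathbb R^2)}^2\big)^{1/2},$$ where $\tilde u$ is the extension of $u$ by zero outside $\Omega$ and $\mathcal F$ is the Fourier transform. For $f\in L^2(\Omega)$, a solution of $$\kappa_1\frac{\partial^\alpha w}{\partial|x|^\alpha}+\kappa_2\frac{\partial^\alpha w}{\partial|y|^\alpha}=f\ \text{ in }\Omega,\qquad w=0\ \text{ on }\partial\Omega, \tag{$D_f$}$$ means a function $w\in H_0^{\alpha/2}(\Omega)$ satisfying the equation in the sense of distributions on $\Omega$. Then the optimal control problem of minimizing $J(u,q)$ over all pairs $(q,u)\in\mathscr K\times L^2(\Omega)$ such that $u$ is a solution of $(D_{g+q})$ has exactly one solution $(q,u)$. Moreover, there is a costate $p$ such that the triplet $(q,p,u)$ satisfies the first-order optimality conditions: $u$ is a solution of $(D_{g+q})$, $p$ is a solution of $(D_{u-u_d})$, and $$\int_\Omega(\gamma q+p)(\delta q-q)\,dx\,dy\ge 0\qquad\text{for all }\delta q\in\mathscr K .$$ -/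

import Mathlib

open MeasureTheory Set Filter Topology
open scoped ContDiff ENNReal FourierTransform

noncomputable section

namespace RieszOCP

/-- The open rectangle `Ω = (a, b) × (c, d)`. -/
def rect (a b c d : ℝ) : Set (ℝ × ℝ) := Ioo a b ×ˢ Ioo c d

/-- The real Hilbert space `L²(Ω)`, `Ω = (a, b) × (c, d)`, with Lebesgue measure. -/
abbrev L2 (a b c d : ℝ) : Type :=
  Lp ℝ 2 ((volume : Measure (ℝ × ℝ)).restrict (rect a b c d))

/-- `φ ∈ C₀^∞(Ω)`: smooth functions with compact support contained in `Ω`. -/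
structure IsTest (Ω : Set (ℝ × ℝ)) (φ : ℝ × ℝ → ℝ) : Prop where
  smooth : ContDiff ℝ ∞ φ
  compact : HasCompactSupport φ
  support_subset : tsupport φ ⊆ Ω

/-! ### The space `H₀^μ(Ω)` -/

/-- The Fourier transform of the extension by zero of `u` outside `Ω`. The frequency space is
the Euclidean plane, and Mathlib's normalization `∫ exp (-2 π i ⟨z, w⟩) ũ(z) dz` is used; another
normalization multiplies the seminorm below by a positive constant. -/
def fourierZeroExt (Ω : Set (ℝ × ℝ)) (u : ℝ × ℝ → ℝ) : EuclideanSpace ℝ (Fin 2) → ℂ :=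
  𝓕 (fun z : EuclideanSpace ℝ (Fin 2) => ((Ω.indicator u (z 0, z 1) : ℝ) : ℂ))

/-- The seminorm `|u|_{H^μ(Ω)} = ‖ |w|^μ 𝓕[ũ] ‖_{L²}`, with value in `[0, ∞]`. -/
def sobolevSeminorm (μ : ℝ) (Ω : Set (ℝ × ℝ)) (u : ℝ × ℝ → ℝ) : ℝ≥0∞ :=
  eLpNorm (fun w : EuclideanSpace ℝ (Fin 2) =>
    ((‖w‖ ^ μ : ℝ) : ℂ) * fourierZeroExt Ω u w) 2 volume

/-- The norm `‖u‖_{H^μ(Ω)} = (‖u‖²_{L²(Ω)} + |u|²_{H^μ(Ω)})^{1/2}`, with value in `[0, ∞]`. -/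
def sobolevNorm (μ : ℝ) (Ω : Set (ℝ × ℝ)) (u : ℝ × ℝ → ℝ) : ℝ≥0∞ :=
  (eLpNorm u 2 (volume.restrict Ω) ^ 2 + sobolevSeminorm μ Ω u ^ 2) ^ (1 / 2 : ℝ)

/-- `u ∈ H₀^μ(Ω)`: `u` lies in the closure of `C₀^∞(Ω)` for the norm `‖·‖_{H^μ(Ω)}`. -/
def MemH0 (μ : ℝ) (Ω : Set (ℝ × ℝ)) (u : ℝ × ℝ → ℝ) : Prop :=
  ∃ φ : ℕ → ℝ × ℝ → ℝ, (∀ n, IsTest Ω (φ n)) ∧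
    Tendsto (fun n => sobolevNorm μ Ω (u - φ n)) atTop (𝓝 0)

/-! ### Riesz derivatives of order `1 < α < 2` -/

/-- The left fractional integral `1 / Γ(2 - α) ∫_a^x (x - t)^{1 - α} f(t) dt`, whose second
derivative is the left Riemann–Liouville derivative of order `α`. -/
def leftInt (α a : ℝ) (f : ℝ → ℝ) (x : ℝ) : ℝ :=
  1 / Real.Gamma (2 - α) * ∫ t in a..x, (x - t) ^ (1 - α) * f t

/-- The right fractional integral `1 / Γ(2 - α) ∫_x^b (t - x)^{1 - α} f(t) dt`, whose second
derivative is the right Riemann–Liouville derivative of order `α`. -/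
def rightInt (α b : ℝ) (f : ℝ → ℝ) (x : ℝ) : ℝ :=
  1 / Real.Gamma (2 - α) * ∫ t in x..b, (t - x) ^ (1 - α) * f t

/-- The Riesz derivative `∂^α u / ∂|x|^α` on `Ω` as a distribution, evaluated at the test function
`φ`: the outer second derivatives `d²/dx²` of the left and right fractional integrals are
distributional derivatives, that is, they are moved onto `φ`. -/
def rieszX (α a b c d : ℝ) (u φ : ℝ × ℝ → ℝ) : ℝ :=
  -1 / (2 * Real.cos (Real.pi * α / 2)) *
    ∫ z in rect a b c d,
      (leftInt α a (fun s => u (s, z.2)) z.1 + rightInt α b (fun s => u (s, z.2)) z.1) *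
        iteratedDeriv 2 (fun s => φ (s, z.2)) z.1

/-- The Riesz derivative `∂^α u / ∂|y|^α` on `Ω` as a distribution, evaluated at `φ`. -/
def rieszY (α a b c d : ℝ) (u φ : ℝ × ℝ → ℝ) : ℝ :=
  -1 / (2 * Real.cos (Real.pi * α / 2)) *
    ∫ z in rect a b c d,
      (leftInt α c (fun s => u (z.1, s)) z.2 + rightInt α d (fun s => u (z.1, s)) z.2) *
        iteratedDeriv 2 (fun s => φ (z.1, s)) z.2

/-- `u` is the (weak) solution of the Dirichlet problem
`κ₁ ∂^α u / ∂|x|^α + κ₂ ∂^α u / ∂|y|^α = f` in `Ω`, `u = 0` on `∂Ω`: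
`u ∈ H₀^{α/2}(Ω)`, which carries the boundary condition (`α / 2 > 1 / 2`), and the equation holds
in the sense of distributions on `Ω`. -/
structure IsSolution (κ₁ κ₂ α a b c d : ℝ) (f u : L2 a b c d) : Prop where
  mem_H0 : MemH0 (α / 2) (rect a b c d) u
  equation : ∀ φ : ℝ × ℝ → ℝ, IsTest (rect a b c d) φ →
    κ₁ * rieszX α a b c d u φ + κ₂ * rieszY α a b c d u φ = ∫ z in rect a b c d, f z * φ z

/-! ### The optimal control problem -/

/-- The admissible controls: `v₁ ≤ q ≤ v₂` a.e. in `Ω`. -/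
def admissible (a b c d v₁ v₂ : ℝ) : Set (L2 a b c d) :=
  {q | ∀ᵐ z ∂((volume : Measure (ℝ × ℝ)).restrict (rect a b c d)), v₁ ≤ q z ∧ q z ≤ v₂}

/-- The cost functional `J(u, q) = ½ ‖u - u_d‖² + (γ / 2) ‖q‖²`. -/
def cost {a b c d : ℝ} (γ : ℝ) (ud u q : L2 a b c d) : ℝ :=
  1 / 2 * ‖u - ud‖ ^ 2 + γ / 2 * ‖q‖ ^ 2

/-- `(q, u) ∈ 𝒦 × L²(Ω)` satisfies the state equation. -/
def Feasible (κ₁ κ₂ α a b c d v₁ v₂ : ℝ) (g q u : L2 a b c d) : Prop :=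
  q ∈ admissible a b c d v₁ v₂ ∧ IsSolution κ₁ κ₂ α a b c d (g + q) u

/-- `(q, u)` solves the optimal control problem. -/
def IsOptimal (κ₁ κ₂ γ α a b c d v₁ v₂ : ℝ) (g ud q u : L2 a b c d) : Prop :=
  Feasible κ₁ κ₂ α a b c d v₁ v₂ g q u ∧
    ∀ q' u' : L2 a b c d, Feasible κ₁ κ₂ α a b c d v₁ v₂ g q' u' →
      cost γ ud u q ≤ cost γ ud u' q'

end RieszOCP

end

/-! The weak problem reduces to a bounded self-adjoint solution operator `S` on L²(Ω), and the
control problem to a projection in a Hilbert space.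

State equation. The sum of the left and right fractional integrals is convolution on the interval
with the even kernel |x - t|^(1-α). Fubini moves it from `u` onto the second derivative of the test
function φ. That derivative vanishes outside Ω, so two integrations by parts on the line turn the
result into α(α-1) ∫₀^∞ h^(-1-α) (φ(z+he) + φ(z-he) - 2φ(z)) dh (`rieszX_eq`). On the Fourier side
this is multiplication by a negative constant times |⟨ξ, e⟩|^α
(`SchwartzMap.fracDiff_eq_fourierInv`). Since cos(πα/2) < 0, minus the operator has the nonnegative
symbol `rieszSymbol`, comparable with |ξ|^α. With `T` the Fourier transform weighted by the square
root of the symbol, ⟨ψ, Aφ⟩ = -⟨Tψ, Tφ⟩ for test functions, and ‖Tφ‖ is equivalent to the H^(α/2)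
seminorm. A Poincaré inequality (`exists_poincare`) bounds the L² norm by ‖Tφ‖, so the inclusion of
test functions extends to a bounded map `j` from the energy space into L². The equation with
right-hand side f then has the unique solution -j j* f (`exists_solution_operator`,
`isSolution_iff`).

Control problem. Up to a factor 1/2, the cost is the squared distance from F q = (S q, √γ q) to a
fixed point. Since F is bounded below and the admissible set is closed and convex, a nearest point
exists. The obtuse angle criterion for it, rewritten by self-adjointness of `S`, is the variational
inequality with costate p = S(u - u_d). Strict convexity gives uniqueness
(`exists_unique_optimal_control`). -/

namespace RieszOCP

/-! ### Abstract Hilbert space theory: weak problem and control problem -/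

section Abstract

variable {L H D : Type*} [NormedAddCommGroup L] [InnerProductSpace ℝ L]
  [NormedAddCommGroup H] [InnerProductSpace ℝ H]
  [AddCommGroup D] [Module ℝ D]

/-- `w` is a limit of `ι (φ n)` for a sequence `φ n` along which `T` converges. -/
def InClosure (ι : D →ₗ[ℝ] L) (T : D →ₗ[ℝ] H) (w : L) : Prop :=
  ∃ (φ : ℕ → D) (U : H), Tendsto (fun n => ι (φ n)) atTop (𝓝 w) ∧
    Tendsto (fun n => T (φ n)) atTop (𝓝 U)

/-- The solution operator of the weak problem associated with the form `⟪T ψ, T φ⟫`. -/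
theorem exists_solution_operator [CompleteSpace L] [CompleteSpace H]
    (ι : D →ₗ[ℝ] L) (T : D →ₗ[ℝ] H) (A : D → L) (C : ℝ)
    (hC : ∀ φ, ‖ι φ‖ ≤ C * ‖T φ‖)
    (hA : ∀ ψ φ, inner ℝ (ι ψ) (A φ) = -inner ℝ (T ψ) (T φ)) :
    ∃ S : L →L[ℝ] L, (∀ f g, inner ℝ (S f) g = inner ℝ f (S g)) ∧
      ∀ f w, (InClosure ι T w ∧ ∀ φ, inner ℝ w (A φ) = inner ℝ f (ι φ)) ↔ w = S f := by
  let W : Submodule ℝ H := (LinearMap.range T).topologicalClosure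
  have : CompleteSpace W :=
    (Submodule.isClosed_topologicalClosure _).completeSpace_coe
  let e : D →ₗ[ℝ] W := T.codRestrict W
    (fun φ => Submodule.le_topologicalClosure _ (LinearMap.mem_range_self T φ))
  have he : ∀ φ, (e φ : H) = T φ := fun φ => rfl
  have hdense : DenseRange e := by
    rw [DenseRange, Subtype.dense_iff]
    intro x hx
    have hx' : x ∈ closure (LinearMap.range T : Set H) := hx
    refine closure_mono ?_ hx'
    rintro _ ⟨φ, rfl⟩
    exact ⟨e φ, ⟨φ, rfl⟩, rfl⟩
  -- The bound `hC` makes T φ ↦ ι φ well defined and bounded on a dense subspace of `W`. Membership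
  -- in the closure then means lying in the range of `j`; injectivity of `j` plays no role.
  let j : W →L[ℝ] L := ι.extendOfNorm e
  have hj : ∀ φ, j (e φ) = ι φ := fun φ =>
    LinearMap.extendOfNorm_eq hdense ⟨C, fun x => by simpa [he] using hC x⟩ φ
  have hjA : ∀ (U : W) φ, inner ℝ (j U) (A φ) = -inner ℝ U (e φ) := by
    intro U φ
    refine hdense.induction_on (p := fun U => inner ℝ (j U) (A φ) = -inner ℝ U (e φ)) U ?_ ?_
    · exact isClosed_eq (by fun_prop) (by fun_prop)
    · intro ψ
      rw [hj, hA]; rfl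
  have hclos : ∀ w, InClosure ι T w ↔ ∃ U, j U = w := by
    intro w
    constructor
    · rintro ⟨φ, U, h1, h2⟩
      have hU : U ∈ W := by
        refine (Submodule.isClosed_topologicalClosure _).mem_of_tendsto h2
          (Eventually.of_forall fun n => (e (φ n)).2)
      refine ⟨⟨U, hU⟩, ?_⟩
      have h3 : Tendsto (fun n => e (φ n)) atTop (𝓝 ⟨U, hU⟩) := by
        rw [tendsto_subtype_rng]; exact h2
      have h4 := (j.continuous.tendsto ⟨U, hU⟩).comp h3
      refine tendsto_nhds_unique h4 ?_
      simpa [Function.comp_def, hj] using h1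
    · rintro ⟨U, rfl⟩
      have hU : U ∈ closure (range e) := hdense U
      obtain ⟨x, hx, hxU⟩ := mem_closure_iff_seq_limit.1 hU
      choose φ hφ using hx
      refine ⟨φ, U, ?_, ?_⟩
      · have h4 := (j.continuous.tendsto U).comp hxU
        refine h4.congr fun n => ?_
        simp only [Function.comp_apply, ← hφ, hj]
      · have := (continuous_subtype_val.tendsto U).comp hxU
        refine this.congr fun n => ?_
        simp only [Function.comp_apply, ← hφ, he]
  -- For w = j U the equation reads -⟨U, e φ⟩ = ⟨j* f, e φ⟩ for all φ, so U = -j* f by density. The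
  -- resulting operator -j j* is visibly self-adjoint.
  refine ⟨-(j ∘L j.adjoint), ?_, ?_⟩
  · intro f g
    simp only [neg_apply, ContinuousLinearMap.comp_apply, inner_neg_left,
      inner_neg_right]
    rw [← ContinuousLinearMap.adjoint_inner_right, ContinuousLinearMap.adjoint_inner_left]
  · intro f w
    rw [hclos]
    constructor
    · rintro ⟨⟨U, rfl⟩, h⟩
      have h0 : U + j.adjoint f = 0 := by
        refine hdense.eq_zero_of_inner_left ℝ fun φ => ?_
        rw [inner_add_left, ContinuousLinearMap.adjoint_inner_left, hj, ← h φ, hjA]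
        ring
      simp [eq_neg_of_add_eq_zero_left h0]
    · rintro rfl
      refine ⟨⟨-j.adjoint f, by simp⟩, fun φ => ?_⟩
      have := hjA (-j.adjoint f) φ
      rw [inner_neg_left, neg_neg, ContinuousLinearMap.adjoint_inner_left, hj] at this
      simpa using this

/-- Existence, uniqueness and first-order conditions for a linear-quadratic control problem with
self-adjoint control-to-state operator. -/
theorem exists_unique_optimal_control [CompleteSpace L] (S : L →L[ℝ] L)
    (hS : ∀ f g, inner ℝ (S f) g = inner ℝ f (S g)) {K : Set L} (hne : K.Nonempty)
    (hclosed : IsClosed K) (hconv : Convex ℝ K) {γ : ℝ} (hγ : 0 < γ) (g ud : L) :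
    ∃ q ∈ K,
      (∀ q' ∈ K, 1 / 2 * ‖S (g + q) - ud‖ ^ 2 + γ / 2 * ‖q‖ ^ 2 ≤
        1 / 2 * ‖S (g + q') - ud‖ ^ 2 + γ / 2 * ‖q'‖ ^ 2) ∧
      (∀ q' ∈ K, 1 / 2 * ‖S (g + q') - ud‖ ^ 2 + γ / 2 * ‖q'‖ ^ 2 ≤
        1 / 2 * ‖S (g + q) - ud‖ ^ 2 + γ / 2 * ‖q‖ ^ 2 → q' = q) ∧
      ∀ δ ∈ K, 0 ≤ inner ℝ (γ • q + S (S (g + q) - ud)) (δ - q) := by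
  let r := Real.sqrt γ
  have hr : 0 < r := Real.sqrt_pos.2 hγ
  have hrr : r * r = γ := Real.mul_self_sqrt hγ.le
  -- The cost is half of ‖F q - z‖² with z = (ud - S g, 0), so minimizing it over K is projecting z
  -- onto F(K).
  let F : L →L[ℝ] WithLp 2 (L × L) :=
    (WithLp.prodContinuousLinearEquiv 2 ℝ L L).symm.toContinuousLinearMap ∘L
      (S.prod (r • ContinuousLinearMap.id ℝ L))
  have hF : ∀ q, F q = WithLp.toLp 2 (S q, r • q) := fun q => rfl
  -- The second component alone gives ‖F x‖ ≥ √γ ‖x‖; this carries completeness from K to its image.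
  have hanti : AntilipschitzWith (Real.toNNReal r⁻¹) F := by
    refine AddMonoidHomClass.antilipschitz_of_bound F fun x => ?_
    rw [Real.coe_toNNReal _ (by positivity)]
    have h1 : ‖(F x).snd‖ ≤ ‖F x‖ := WithLp.norm_snd_le _ _
    have h2 : (F x).snd = r • x := rfl
    rw [h2, norm_smul, Real.norm_of_nonneg hr.le] at h1
    rw [inv_mul_eq_div, le_div_iff₀ hr]; linarith
  let z : WithLp 2 (L × L) := WithLp.toLp 2 (ud - S g, 0)
  have hcomp : IsComplete (F '' K) :=
    (hanti.isUniformInducing F.uniformContinuous).isComplete_iff.2 hclosed.isComplete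
  have hconv' : Convex ℝ (F '' K) := hconv.linear_image F.toLinearMap
  obtain ⟨_, ⟨q, hq, rfl⟩, hmin⟩ :=
    exists_norm_eq_iInf_of_complete_convex (hne.image F) hcomp hconv' z
  rw [norm_eq_iInf_iff_real_inner_le_zero hconv' ⟨q, hq, rfl⟩] at hmin
  have key : ∀ δ ∈ K, 0 ≤ inner ℝ (γ • q + S (S (g + q) - ud)) (δ - q) := by
    intro δ hδ
    have h := hmin (F δ) ⟨δ, hδ, rfl⟩
    have e1 : z - F q = WithLp.toLp 2 (ud - S g - S q, -(r • q)) := by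
      rw [hF, ← WithLp.toLp_sub]; simp
    have e2 : F δ - F q = WithLp.toLp 2 (S (δ - q), r • (δ - q)) := by
      rw [hF, hF, ← WithLp.toLp_sub, map_sub, smul_sub]; rfl
    rw [e1, e2, WithLp.prod_inner_apply] at h
    simp only [inner_neg_left, real_inner_smul_left, real_inner_smul_right] at h
    rw [inner_add_left, real_inner_smul_left, hS, ← hrr]
    have e3 : S (g + q) - ud = -(ud - S g - S q) := by rw [map_add]; abel
    rw [e3, inner_neg_left]
    linarith
  -- Exact second-order expansion of the cost at q. The linear term is nonnegative on K by `key`,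
  -- and the quadratic remainder is at least γ/2 ‖q' - q‖², which yields both minimality and
  -- uniqueness.
  have expand : ∀ q' : L, 1 / 2 * ‖S (g + q') - ud‖ ^ 2 + γ / 2 * ‖q'‖ ^ 2 =
      1 / 2 * ‖S (g + q) - ud‖ ^ 2 + γ / 2 * ‖q‖ ^ 2 +
        inner ℝ (γ • q + S (S (g + q) - ud)) (q' - q) +
        (1 / 2 * ‖S (q' - q)‖ ^ 2 + γ / 2 * ‖q' - q‖ ^ 2) := by
    intro q'
    have h1 : S (g + q') - ud = (S (g + q) - ud) + S (q' - q) := by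
      simp only [map_add, map_sub]; abel
    have h2 : ‖q'‖ ^ 2 = ‖q‖ ^ 2 + 2 * inner ℝ q (q' - q) + ‖q' - q‖ ^ 2 := by
      rw [← norm_add_sq_real]; simp
    rw [h1, norm_add_sq_real, h2, inner_add_left, real_inner_smul_left, hS]
    ring
  refine ⟨q, hq, fun q' hq' => ?_, fun q' hq' hle => ?_, key⟩
  · rw [expand q']
    have := key q' hq'
    have : 0 ≤ 1 / 2 * ‖S (q' - q)‖ ^ 2 + γ / 2 * ‖q' - q‖ ^ 2 := by positivity
    linarith
  · rw [expand q'] at hle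
    have h1 := key q' hq'
    have h2 : 0 ≤ 1 / 2 * ‖S (q' - q)‖ ^ 2 := by positivity
    have h3 : 0 ≤ ‖q' - q‖ ^ 2 := by positivity
    have h4 : ‖q' - q‖ ^ 2 = 0 := by
      refine le_antisymm ?_ h3
      by_contra hcon
      have := mul_pos (half_pos hγ) (not_le.1 hcon)
      linarith
    rw [← sub_eq_zero]
    simpa using h4

end Abstract

/-! ### Second differences against the singular kernel -/

section SecondDifference

/-- The mean value inequality is applied twice: as a function of the step, the second difference
vanishes at 0 and has derivative of size at most 2Mh on [0, h]. -/
theorem norm_second_difference_le {F : Type*} [NormedAddCommGroup F] [NormedSpace ℝ F]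
    {ψ ψ' ψ'' : ℝ → F} (h₁ : ∀ x, HasDerivAt ψ (ψ' x) x) (h₂ : ∀ x, HasDerivAt ψ' (ψ'' x) x)
    {M : ℝ} (hM : ∀ x, ‖ψ'' x‖ ≤ M) (x : ℝ) {h : ℝ} (hh : 0 ≤ h) :
    ‖ψ (x + h) + ψ (x - h) - (2 : ℝ) • ψ x‖ ≤ 2 * M * h ^ 2 := by
  have hS : ∀ t, HasDerivAt (fun t => ψ (x + t) + ψ (x - t) - (2 : ℝ) • ψ x)
      (ψ' (x + t) - ψ' (x - t)) t := by
    intro t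
    have a1 := (h₁ (x + t)).comp_const_add x t
    have a2 := (h₁ (x - t)).comp_const_sub x t
    simpa [sub_eq_add_neg] using (a1.add a2).sub_const ((2 : ℝ) • ψ x)
  have hb : ∀ t ∈ Icc 0 h, ‖ψ' (x + t) - ψ' (x - t)‖ ≤ 2 * M * h := by
    intro t ht
    have := convex_univ.norm_image_sub_le_of_norm_hasDerivWithin_le (f := ψ') (f' := ψ'')
      (fun y _ => (h₂ y).hasDerivWithinAt) (fun y _ => hM y) (mem_univ (x - t)) (mem_univ (x + t))
    refine this.trans ?_
    have hM0 : 0 ≤ M := (norm_nonneg _).trans (hM 0)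
    have e : x + t - (x - t) = 2 * t := by ring
    rw [e, Real.norm_of_nonneg (by linarith [ht.1])]
    nlinarith [ht.2]
  have := (convex_Icc (0 : ℝ) h).norm_image_sub_le_of_norm_hasDerivWithin_le
    (f := fun t => ψ (x + t) + ψ (x - t) - (2 : ℝ) • ψ x)
    (fun t _ => (hS t).hasDerivWithinAt) hb (left_mem_Icc.2 hh) (right_mem_Icc.2 hh)
  have e0 : ψ (x + 0) + ψ (x - 0) - (2 : ℝ) • ψ x = 0 := by
    simp [two_smul]
  rw [e0, sub_zero, sub_zero, Real.norm_of_nonneg hh] at this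
  exact this.trans_eq (by ring)

theorem integrableOn_Ioi_rpow_mul_min {α : ℝ} (hα₁ : 1 < α) (hα₂ : α < 2) :
    IntegrableOn (fun h : ℝ => h ^ (-1 - α) * min (h ^ 2) 1) (Ioi 0) := by
  rw [← Ioc_union_Ioi_eq_Ioi zero_le_one]
  refine IntegrableOn.union ?_ ?_
  · have h1 : IntegrableOn (fun h : ℝ => h ^ (1 - α)) (Ioc 0 1) :=
      (intervalIntegrable_iff_integrableOn_Ioc_of_le zero_le_one).1
        (intervalIntegral.intervalIntegrable_rpow' (by linarith))
    refine h1.congr_fun (fun h hh => ?_) measurableSet_Ioc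
    have : h ^ 2 ≤ 1 := pow_le_one₀ hh.1.le hh.2
    simp only [min_eq_left this]
    rw [← Real.rpow_natCast h 2, ← Real.rpow_add hh.1]
    norm_num; ring_nf
  · have h1 : IntegrableOn (fun h : ℝ => h ^ (-1 - α)) (Ioi 1) :=
      integrableOn_Ioi_rpow_of_lt (by linarith) zero_lt_one
    refine h1.congr_fun (fun h hh => ?_) measurableSet_Ioi
    have : 1 ≤ h ^ 2 := one_le_pow₀ (mem_Ioi.1 hh).le
    simp [min_eq_right this]

/-- A function bounded by a multiple of `min (h ^ 2) 1` is integrable against `h ^ (-1 - α)`. -/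
theorem integrableOn_Ioi_rpow_mul_of_le {F : Type*} [NormedAddCommGroup F] [NormedSpace ℝ F]
    {α : ℝ} (hα₁ : 1 < α) (hα₂ : α < 2)
    {S : ℝ → F} (hS : AEStronglyMeasurable S (volume.restrict (Ioi 0))) {M : ℝ}
    (hM : ∀ h, 0 ≤ h → ‖S h‖ ≤ M * min (h ^ 2) 1) :
    IntegrableOn (fun h : ℝ => h ^ (-1 - α) • S h) (Ioi 0) := by
  refine ((integrableOn_Ioi_rpow_mul_min hα₁ hα₂).const_mul M).mono'
    (AEStronglyMeasurable.smul (by fun_prop) hS) ?_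
  filter_upwards [ae_restrict_mem measurableSet_Ioi] with h hh
  have hh' : 0 < h := hh
  rw [norm_smul, Real.norm_of_nonneg (by positivity)]
  calc h ^ (-1 - α) * ‖S h‖ ≤ h ^ (-1 - α) * (M * min (h ^ 2) 1) := by
        gcongr; exact hM h hh'.le
    _ = _ := by ring

/-- Two integrations by parts in h. At 0 the boundary terms are O(h^(2-α)), because the first
difference of ψ' is O(h) and the second difference of ψ is O(h²). The factors -(1-α) and -(-α)
produce α(α-1). -/
theorem integral_rpow_mul_second_difference {α : ℝ} (hα₁ : 1 < α) (hα₂ : α < 2)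
    {ψ : ℝ → ℝ} (hψ : ContDiff ℝ ∞ ψ) (hc : HasCompactSupport ψ) (x : ℝ) :
    ∫ h in Ioi (0 : ℝ), h ^ (1 - α) *
        (iteratedDeriv 2 ψ (x + h) + iteratedDeriv 2 ψ (x - h)) =
      α * (α - 1) * ∫ h in Ioi (0 : ℝ), h ^ (-1 - α) * (ψ (x + h) + ψ (x - h) - 2 * ψ x) := by
  have hψ1 : ContDiff ℝ ∞ (deriv ψ) := hψ.deriv'
  have hψ2 : ContDiff ℝ ∞ (deriv (deriv ψ)) := hψ1.deriv'
  have hc1 : HasCompactSupport (deriv ψ) := hc.deriv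
  have hc2 : HasCompactSupport (deriv (deriv ψ)) := hc1.deriv
  have e2 : iteratedDeriv 2 ψ = deriv (deriv ψ) := by
    rw [iteratedDeriv_succ, iteratedDeriv_one]
  rw [e2]
  have d0 : ∀ y, HasDerivAt ψ (deriv ψ y) y := fun y =>
    (hψ.differentiable (by simp) y).hasDerivAt
  have d1 : ∀ y, HasDerivAt (deriv ψ) (deriv (deriv ψ) y) y := fun y =>
    (hψ1.differentiable (by simp) y).hasDerivAt
  obtain ⟨M, hM⟩ := hc2.exists_bound_of_continuous hψ2.continuous
  have hM0 : 0 ≤ M := (norm_nonneg _).trans (hM 0)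
  obtain ⟨R, hR0, hR⟩ : ∃ R : ℝ, 0 < R ∧ ∀ h, R < h → ψ (x + h) = 0 ∧ ψ (x - h) = 0 ∧
      deriv ψ (x + h) = 0 ∧ deriv ψ (x - h) = 0 ∧
      deriv (deriv ψ) (x + h) = 0 ∧ deriv (deriv ψ) (x - h) = 0 := by
    obtain ⟨R, hR0, hR⟩ := hc.isCompact.isBounded.subset_closedBall_lt 0 x
    have hz : ∀ y, R < |y - x| → y ∉ tsupport ψ := fun y hy hmem => by
      have := hR hmem
      rw [Metric.mem_closedBall, Real.dist_eq] at this
      linarith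
    have hs1 : ∀ y, y ∉ tsupport ψ → deriv ψ y = 0 := fun y hy => by
      by_contra hcon; exact hy (support_deriv_subset hcon)
    have hs2 : ∀ y, y ∉ tsupport ψ → deriv (deriv ψ) y = 0 := fun y hy => by
      by_contra hcon
      exact hy ((closure_minimal support_deriv_subset (isClosed_tsupport ψ))
        (support_deriv_subset hcon))
    refine ⟨R, hR0, fun h hh => ?_⟩
    have p1 := hz (x + h) (by rw [add_sub_cancel_left]; exact hh.trans_le (le_abs_self h))
    have p2 := hz (x - h) (by
      rw [sub_sub_cancel_left, abs_neg]; exact hh.trans_le (le_abs_self h))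
    exact ⟨image_eq_zero_of_notMem_tsupport p1, image_eq_zero_of_notMem_tsupport p2,
      hs1 _ p1, hs1 _ p2, hs2 _ p1, hs2 _ p2⟩
  set S : ℝ → ℝ := fun h => ψ (x + h) + ψ (x - h) - 2 * ψ x with hS
  set S1 : ℝ → ℝ := fun h => deriv ψ (x + h) - deriv ψ (x - h) with hS1
  set S2 : ℝ → ℝ := fun h => deriv (deriv ψ) (x + h) + deriv (deriv ψ) (x - h) with hS2
  have dS : ∀ h, HasDerivAt S (S1 h) h := fun h => by
    simpa [hS, hS1, sub_eq_add_neg] using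
      (((d0 (x + h)).comp_const_add x h).add ((d0 (x - h)).comp_const_sub x h)).sub_const (2 * ψ x)
  have dS1 : ∀ h, HasDerivAt S1 (S2 h) h := fun h => by
    have := ((d1 (x + h)).comp_const_add x h).sub ((d1 (x - h)).comp_const_sub x h)
    rw [sub_neg_eq_add] at this
    exact this
  have bS : ∀ h, 0 ≤ h → |S h| ≤ 2 * M * h ^ 2 := fun h hh => by
    simpa using norm_second_difference_le d0 d1 hM x hh
  have bS1 : ∀ h, 0 ≤ h → |S1 h| ≤ 2 * M * h := fun h hh => by
    have := convex_univ.norm_image_sub_le_of_norm_hasDerivWithin_le (f := deriv ψ)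
      (fun y _ => (d1 y).hasDerivWithinAt) (fun y _ => hM y) (mem_univ (x - h)) (mem_univ (x + h))
    have e : x + h - (x - h) = 2 * h := by ring
    rw [e, Real.norm_of_nonneg (by linarith : (0 : ℝ) ≤ 2 * h)] at this
    exact this.trans_eq (by ring)
  have bS2 : ∀ h, |S2 h| ≤ 2 * M := fun h => by
    have := norm_add_le (deriv (deriv ψ) (x + h)) (deriv (deriv ψ) (x - h))
    exact this.trans (by linarith [hM (x + h), hM (x - h)])
  have cS : Continuous S := by have := hψ.continuous; fun_prop
  have cS1 : Continuous S1 := by have := hψ1.continuous; fun_prop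
  have cS2 : Continuous S2 := by have := hψ2.continuous; fun_prop
  have hloc : IntegrableOn (fun h : ℝ => h ^ (1 - α)) (Ioc 0 R) :=
    (intervalIntegrable_iff_integrableOn_Ioc_of_le hR0.le).1
      (intervalIntegral.intervalIntegrable_rpow' (by linarith))
  have gen : ∀ G : ℝ → ℝ, AEStronglyMeasurable G (volume.restrict (Ioi 0)) →
      (∀ h, R < h → G h = 0) → (∀ h, 0 < h → |G h| ≤ 2 * M * h ^ (1 - α)) →
      IntegrableOn G (Ioi 0) := by
    intro G hG hG0 hGb
    rw [← Ioc_union_Ioi_eq_Ioi hR0.le]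
    refine IntegrableOn.union ?_ ?_
    · refine (hloc.const_mul (2 * M)).mono'
        (hG.mono_measure (Measure.restrict_mono Ioc_subset_Ioi_self le_rfl)) ?_
      filter_upwards [ae_restrict_mem measurableSet_Ioc] with h hh
      exact hGb h hh.1
    · exact (integrableOn_zero (ε' := ℝ)).congr_fun (fun h hh => (hG0 h hh).symm) measurableSet_Ioi
  have i2 : IntegrableOn (fun h => h ^ (1 - α) * S2 h) (Ioi 0) := by
    refine gen _ (AEStronglyMeasurable.mul (by fun_prop) cS2.aestronglyMeasurable) ?_ ?_
    · intro h hh; simp [hS2, hR h hh]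
    · intro h hh
      rw [abs_mul, abs_of_pos (by positivity), mul_comm]
      gcongr; exact bS2 h
  have i1 : IntegrableOn (fun h => h ^ (-α) * S1 h) (Ioi 0) := by
    refine gen _ (AEStronglyMeasurable.mul (by fun_prop) cS1.aestronglyMeasurable) ?_ ?_
    · intro h hh; simp [hS1, hR h hh]
    · intro h hh
      rw [abs_mul, abs_of_pos (by positivity)]
      calc h ^ (-α) * |S1 h| ≤ h ^ (-α) * (2 * M * h) := by gcongr; exact bS1 h hh.le
        _ = 2 * M * (h ^ (-α) * h ^ (1 : ℝ)) := by rw [Real.rpow_one]; ring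
        _ = _ := by rw [← Real.rpow_add hh]; ring_nf
  -- Unlike `S1` and `S2`, `S` need not vanish for large h, so `gen` is replaced by a bound that is
  -- quadratic near 0 and constant at infinity.
  have i0 : IntegrableOn (fun h => h ^ (-1 - α) * S h) (Ioi 0) := by
    obtain ⟨B, hB⟩ := hc.exists_bound_of_continuous hψ.continuous
    refine integrableOn_Ioi_rpow_mul_of_le hα₁ hα₂ (M := 2 * M + 4 * B)
      cS.aestronglyMeasurable fun h hh => ?_
    have hB0 : 0 ≤ B := (norm_nonneg _).trans (hB 0)
    have b2 : ‖S h‖ ≤ 4 * B := by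
      refine (norm_sub_le _ _).trans ?_
      have := norm_add_le (ψ (x + h)) (ψ (x - h))
      rw [norm_mul, Real.norm_of_nonneg (by norm_num : (0 : ℝ) ≤ 2)]
      linarith [hB (x + h), hB (x - h), hB x]
    rcases le_total (h ^ 2) 1 with h1 | h1
    · rw [min_eq_left h1]
      have := bS h hh
      rw [Real.norm_eq_abs]
      nlinarith [sq_nonneg h]
    · rw [min_eq_right h1]
      linarith
  have hpow : Tendsto (fun h : ℝ => 2 * M * h ^ (2 - α)) (𝓝[>] 0) (𝓝 0) := by
    have : ContinuousAt (fun h : ℝ => 2 * M * h ^ (2 - α)) 0 :=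
      (Real.continuousAt_rpow_const 0 (2 - α) (Or.inr (by linarith))).const_mul _
    have h2 := this.tendsto.mono_left (nhdsWithin_le_nhds (s := Ioi 0))
    simpa [Real.zero_rpow (by linarith : (2 - α) ≠ 0)] using h2
  have z1 : Tendsto ((fun h : ℝ => h ^ (1 - α)) * S1) (𝓝[>] 0) (𝓝 0) := by
    refine squeeze_zero_norm' ?_ hpow
    filter_upwards [self_mem_nhdsWithin] with h hh
    have hh' : 0 < h := hh
    rw [Pi.mul_apply, norm_mul, Real.norm_of_nonneg (by positivity), Real.norm_eq_abs]
    calc h ^ (1 - α) * |S1 h| ≤ h ^ (1 - α) * (2 * M * h) := by gcongr; exact bS1 h hh'.le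
      _ = 2 * M * (h ^ (1 - α) * h ^ (1 : ℝ)) := by rw [Real.rpow_one]; ring
      _ = _ := by rw [← Real.rpow_add hh']; ring_nf
  have z0 : Tendsto ((fun h : ℝ => h ^ (-α)) * S) (𝓝[>] 0) (𝓝 0) := by
    refine squeeze_zero_norm' ?_ hpow
    filter_upwards [self_mem_nhdsWithin] with h hh
    have hh' : 0 < h := hh
    rw [Pi.mul_apply, norm_mul, Real.norm_of_nonneg (by positivity), Real.norm_eq_abs]
    calc h ^ (-α) * |S h| ≤ h ^ (-α) * (2 * M * h ^ 2) := by gcongr; exact bS h hh'.le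
      _ = 2 * M * (h ^ (-α) * h ^ (2 : ℝ)) := by rw [Real.rpow_two]; ring
      _ = _ := by rw [← Real.rpow_add hh']; ring_nf
  have t1 : Tendsto ((fun h : ℝ => h ^ (1 - α)) * S1) atTop (𝓝 0) := by
    refine tendsto_const_nhds.congr' ?_
    filter_upwards [eventually_gt_atTop R] with h hh
    simp [hS1, hR h hh]
  -- Beyond R, `S` is the constant -2ψ(x); the decay comes from h^(-α).
  have t0 : Tendsto ((fun h : ℝ => h ^ (-α)) * S) atTop (𝓝 0) := by
    have : Tendsto (fun h : ℝ => h ^ (-α) * (-2 * ψ x)) atTop (𝓝 0) := by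
      simpa using (tendsto_rpow_neg_atTop (by linarith : 0 < α)).mul_const (-2 * ψ x)
    refine this.congr' ?_
    filter_upwards [eventually_gt_atTop R] with h hh
    simp [hS, hR h hh]
  have s1 := integral_Ioi_mul_deriv_eq_deriv_mul (u := fun h : ℝ => h ^ (1 - α))
    (u' := fun h => (1 - α) * h ^ (-α)) (v := S1) (v' := S2)
    (fun h hh => by
      have := Real.hasDerivAt_rpow_const (x := h) (p := 1 - α) (Or.inl (ne_of_gt hh))
      convert! this using 2; ring_nf) (fun h _ => dS1 h) i2
    (by
      refine IntegrableOn.congr_fun (i1.const_mul (1 - α)) (fun h _ => ?_) measurableSet_Ioi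
      simp [mul_assoc]) z1 t1
  have s0 := integral_Ioi_mul_deriv_eq_deriv_mul (u := fun h : ℝ => h ^ (-α))
    (u' := fun h => (-α) * h ^ (-1 - α)) (v := S) (v' := S1)
    (fun h hh => by
      have := Real.hasDerivAt_rpow_const (x := h) (p := -α) (Or.inl (ne_of_gt hh))
      convert! this using 2; ring_nf) (fun h _ => dS h) i1
    (by
      refine IntegrableOn.congr_fun (i0.const_mul (-α)) (fun h _ => ?_) measurableSet_Ioi
      simp [mul_assoc]) z0 t0
  simp only [mul_assoc, integral_const_mul] at s1 s0
  rw [s1, s0]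
  ring

end SecondDifference

/-! ### The one-dimensional multiplier constant -/

section RieszConst

/-- `∫₀^∞ h^{-1-α} (2 - 2 cos (2 π h)) dh`, the multiplier of the one-dimensional fractional
Laplacian at frequency one. -/
noncomputable def rieszConst (α : ℝ) : ℝ :=
  ∫ h in Ioi (0 : ℝ), h ^ (-1 - α) * (2 - 2 * Real.cos (2 * Real.pi * h))

theorem two_sub_two_cos_le (t : ℝ) :
    ‖2 - 2 * Real.cos (2 * Real.pi * t)‖ ≤ (4 * Real.pi ^ 2 + 4) * min (t ^ 2) 1 := by
  have h1 := Real.cos_le_one (2 * Real.pi * t)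
  have h2 := Real.neg_one_le_cos (2 * Real.pi * t)
  have h3 := Real.one_sub_sq_div_two_le_cos (x := 2 * Real.pi * t)
  rw [Real.norm_of_nonneg (by linarith)]
  rcases le_total (t ^ 2) 1 with h | h
  · rw [min_eq_left h]; nlinarith [sq_nonneg t]
  · rw [min_eq_right h]; nlinarith [sq_nonneg Real.pi]

theorem integrableOn_rieszConst {α : ℝ} (hα₁ : 1 < α) (hα₂ : α < 2) :
    IntegrableOn (fun h : ℝ => h ^ (-1 - α) * (2 - 2 * Real.cos (2 * Real.pi * h))) (Ioi 0) :=
  integrableOn_Ioi_rpow_mul_of_le hα₁ hα₂ (by fun_prop) (fun t _ => two_sub_two_cos_le t)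

/-- The integrand is nonnegative and can vanish only at integers h, hence nowhere on (0, 1). Only
the sign of the constant matters later, not its value. -/
theorem rieszConst_pos {α : ℝ} (hα₁ : 1 < α) (hα₂ : α < 2) : 0 < rieszConst α := by
  have hnn : ∀ h : ℝ, 0 < h →
      0 ≤ h ^ (-1 - α) * (2 - 2 * Real.cos (2 * Real.pi * h)) := fun h hh =>
    mul_nonneg (by positivity) (by linarith [Real.cos_le_one (2 * Real.pi * h)])
  rw [rieszConst, setIntegral_pos_iff_support_of_nonneg_ae _ (integrableOn_rieszConst hα₁ hα₂)]
  · refine lt_of_lt_of_le ?_ (measure_mono (s := Ioo (0 : ℝ) 1) ?_)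
    · simp
    · intro h hh
      refine ⟨?_, hh.1⟩
      refine mul_ne_zero (Real.rpow_pos_of_pos hh.1 _).ne' ?_
      intro h0
      have hcos : Real.cos (2 * Real.pi * h) = 1 := by linarith
      obtain ⟨n, hn⟩ := (Real.cos_eq_one_iff _).1 hcos
      have hnh : (n : ℝ) = h := by
        have := Real.pi_pos
        field_simp at hn
        linarith
      have h1 := hh.1
      have h2 := hh.2
      rw [← hnh] at h1 h2
      norm_cast at h1 h2
      omega
  · filter_upwards [ae_restrict_mem measurableSet_Ioi] with h hh using hnn h hh

/-- Scaling h by |s| and evenness of the cosine: the kernel contributes |s|^(1+α) and the change of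
variables |s|^(-1). -/
theorem integral_rpow_mul_two_sub_two_cos {α : ℝ} (hα₁ : 1 < α) (s : ℝ) :
    ∫ h in Ioi (0 : ℝ), h ^ (-1 - α) * (2 - 2 * Real.cos (2 * Real.pi * (h * s))) =
      rieszConst α * |s| ^ α := by
  rcases eq_or_ne s 0 with rfl | hs
  · simp [Real.zero_rpow (by linarith : α ≠ 0)]
  · have hs' : 0 < |s| := abs_pos.2 hs
    have := integral_comp_mul_left_Ioi
      (fun h : ℝ => h ^ (-1 - α) * (2 - 2 * Real.cos (2 * Real.pi * h))) 0 hs'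
    rw [mul_zero, smul_eq_mul] at this
    have e : ∀ h ∈ Ioi (0 : ℝ), h ^ (-1 - α) * (2 - 2 * Real.cos (2 * Real.pi * (h * s))) =
        |s| ^ (1 + α) * ((|s| * h) ^ (-1 - α) * (2 - 2 * Real.cos (2 * Real.pi * (|s| * h)))) := by
      intro h hh
      have hh' : 0 < h := hh
      have c : Real.cos (2 * Real.pi * (|s| * h)) = Real.cos (2 * Real.pi * (h * s)) := by
        rcases abs_choice s with h' | h' <;> rw [h']
        · ring_nf
        · rw [← Real.cos_neg]; ring_nf
      have p : |s| ^ (1 + α) * |s| ^ (-1 - α) = 1 := by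
        rw [← Real.rpow_add hs']; ring_nf; exact Real.rpow_zero _
      rw [Real.mul_rpow hs'.le hh'.le, c]
      linear_combination (-(h ^ (-1 - α) * (2 - 2 * Real.cos (2 * Real.pi * (h * s))))) * p
    rw [setIntegral_congr_fun measurableSet_Ioi e, integral_const_mul, this, ← rieszConst,
      Real.rpow_add hs', Real.rpow_one]
    field_simp

end RieszConst

/-- The regularized fractional second difference
`∫₀^∞ h^{-1-α} (φ (z + h e) + φ (z - h e) - 2 φ z) dh` in the direction `e`. -/
noncomputable def fracDiff {V F : Type*} [AddCommGroup V] [Module ℝ V]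
    [NormedAddCommGroup F] [NormedSpace ℝ F] (α : ℝ) (e : V) (φ : V → F) (z : V) : F :=
  ∫ h in Ioi (0 : ℝ), h ^ (-1 - α) • (φ (z + h • e) + φ (z - h • e) - (2 : ℝ) • φ z)

/-! ### The kernel |x - t|^p on an interval -/

section Kernel

theorem integrableOn_abs_rpow {p : ℝ} (hp : -1 < p) {R : ℝ} (hR : 0 ≤ R) :
    IntegrableOn (fun t : ℝ => |t| ^ p) (Ioc (-R) R) := by
  have h1 : IntegrableOn (fun t : ℝ => |t| ^ p) (Ioc 0 R) := by
    refine ((intervalIntegrable_iff_integrableOn_Ioc_of_le hR).1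
      (intervalIntegral.intervalIntegrable_rpow' hp)).congr_fun (fun t ht => ?_) measurableSet_Ioc
    simp only [abs_of_pos ht.1]
  have h2 : IntervalIntegrable (fun t : ℝ => |t| ^ p) volume 0 (-R) := by
    have h3 := ((intervalIntegrable_iff_integrableOn_Ioc_of_le hR).2 h1)
    rw [intervalIntegrable_iff_integrableOn_Ioc_of_le hR] at h3
    have := (IntervalIntegrable.iff_comp_neg (f := fun t : ℝ => |t| ^ p) (a := 0) (b := R)).1
      ((intervalIntegrable_iff_integrableOn_Ioc_of_le hR).2 h1)
    simpa using this
  have h4 := h2.symm.trans ((intervalIntegrable_iff_integrableOn_Ioc_of_le hR).2 h1)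
  exact (intervalIntegrable_iff_integrableOn_Ioc_of_le (by linarith)).1 h4

/-- For x in (a, b) the translated interval stays inside [-(b-a), b-a], which makes the bound
independent of x, as Fubini requires below. -/
theorem integrableOn_abs_sub_rpow {p : ℝ} (hp : -1 < p) {a b x : ℝ} (hx : x ∈ Ioo a b) :
    IntegrableOn (fun t : ℝ => |x - t| ^ p) (Ioo a b) ∧
      ∫ t in Ioo a b, |x - t| ^ p ≤ ∫ t in Ioc (-(b - a)) (b - a), |t| ^ p := by
  have hR : 0 ≤ b - a := by linarith [hx.1, hx.2]
  have hK := integrableOn_abs_rpow hp hR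
  rw [← integrable_indicator_iff measurableSet_Ioc] at hK
  have hK' := hK.comp_sub_left x
  have hsub : ∀ t ∈ Ioo a b, (Ioc (-(b - a)) (b - a)).indicator (fun t : ℝ => |t| ^ p) (x - t) =
      |x - t| ^ p := by
    intro t ht
    rw [indicator_of_mem]
    exact ⟨by linarith [hx.1, ht.2], by linarith [hx.2, ht.1]⟩
  refine ⟨hK'.integrableOn.congr_fun hsub measurableSet_Ioo, ?_⟩
  rw [← setIntegral_congr_fun measurableSet_Ioo hsub, ← integral_indicator measurableSet_Ioc,
    ← integral_sub_left_eq_self _ volume x]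
  refine setIntegral_le_integral hK' (Eventually.of_forall fun t => ?_)
  exact indicator_nonneg (fun _ _ => by positivity) _

theorem integral_abs_sub_rpow_mul {p : ℝ} (x : ℝ) (g : ℝ → ℝ)
    (hg : Integrable (fun t : ℝ => |x - t| ^ p * g t)) :
    ∫ t, |x - t| ^ p * g t = ∫ h in Ioi (0 : ℝ), h ^ p * (g (x + h) + g (x - h)) := by
  have h1 : Integrable (fun t : ℝ => |t| ^ p * g (x + t)) := by
    refine (hg.comp_add_left x).congr (Eventually.of_forall fun t => ?_)
    simp
  rw [← integral_add_left_eq_self _ x]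
  simp only [sub_add_cancel_left, abs_neg]
  rw [← intervalIntegral.integral_Iic_add_Ioi (b := 0) h1.integrableOn h1.integrableOn]
  have h2 := integral_comp_neg_Ioi 0 (fun t : ℝ => |t| ^ p * g (x + t))
  rw [neg_zero] at h2
  rw [← h2, ← integral_add]
  · refine setIntegral_congr_fun measurableSet_Ioi fun h hh => ?_
    have hh' : 0 < h := hh
    simp only [abs_neg, abs_of_pos hh', sub_eq_add_neg]
    ring
  · exact h1.comp_neg.integrableOn
  · exact h1.integrableOn

end Kernel

/-! ### Moving the kernel from one factor to the other -/

section Swap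

theorem measurePreserving_swap_outer {X Y : Type*} [MeasurableSpace X] [MeasurableSpace Y]
    (μ : Measure X) (ν : Measure Y) [SFinite μ] [SFinite ν] :
    MeasurePreserving (fun p : (X × Y) × X => ((p.2, p.1.2), p.1.1))
      ((μ.prod ν).prod μ) ((μ.prod ν).prod μ) := by
  have h1 := measurePreserving_prodAssoc μ ν μ
  have h2 : MeasurePreserving Prod.swap (μ.prod (ν.prod μ)) ((ν.prod μ).prod μ) :=
    Measure.measurePreserving_swap
  have h3 : MeasurePreserving (Prod.map Prod.swap id) ((ν.prod μ).prod μ) ((μ.prod ν).prod μ) :=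
    (Measure.measurePreserving_swap (μ := ν) (ν := μ)).prod (MeasurePreserving.id μ)
  exact h3.comp (h2.comp h1)

/-- Fubini for a convolution-type kernel acting in the first variable. -/
theorem integral_kernel_swap {μ ν : Measure ℝ} [SFinite μ] [SFinite ν] {k : ℝ → ℝ}
    (hk : Measurable k) {B : ℝ}
    (hkB : ∀ᵐ x ∂μ, Integrable (fun t => k (x - t)) μ ∧ ∫ t, ‖k (x - t)‖ ∂μ ≤ B)
    (heven : ∀ t, k (-t) = k t) {u : ℝ × ℝ → ℝ} (hu : Integrable u (μ.prod ν))
    {g : ℝ × ℝ → ℝ} (hg : Continuous g) {M : ℝ} (hM : ∀ z, ‖g z‖ ≤ M) :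
    (∀ᵐ z ∂(μ.prod ν), Integrable (fun t => k (z.1 - t) * u (t, z.2)) μ) ∧
      ∫ z, (∫ t, k (z.1 - t) * u (t, z.2) ∂μ) * g z ∂(μ.prod ν) =
        ∫ z, u z * (∫ t, k (z.1 - t) * g (t, z.2) ∂μ) ∂(μ.prod ν) := by
  let σ : (ℝ × ℝ) × ℝ → (ℝ × ℝ) × ℝ := fun p => ((p.2, p.1.2), p.1.1)
  have hσ : MeasurePreserving σ ((μ.prod ν).prod μ) ((μ.prod ν).prod μ) :=
    measurePreserving_swap_outer μ ν
  have hkm : Measurable fun p : (ℝ × ℝ) × ℝ => k (p.1.1 - p.2) := by fun_prop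
  have hkB' : ∀ᵐ z ∂(μ.prod ν), Integrable (fun t => k (z.1 - t)) μ ∧
      ∫ t, ‖k (z.1 - t)‖ ∂μ ≤ B :=
    (Measure.quasiMeasurePreserving_fst (μ := μ) (ν := ν)).ae hkB
  -- In this order the inner variable meets only the kernel, so the uniform bound `B` and
  -- integrability of `u` suffice. The other order follows by the exchange σ and evenness of `k`.
  have hH : Integrable (fun p : (ℝ × ℝ) × ℝ => k (p.1.1 - p.2) * u p.1) ((μ.prod ν).prod μ) := by
    have hm : AEStronglyMeasurable (fun p : (ℝ × ℝ) × ℝ => k (p.1.1 - p.2) * u p.1)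
        ((μ.prod ν).prod μ) :=
      hkm.aestronglyMeasurable.mul hu.aestronglyMeasurable.comp_fst
    rw [integrable_prod_iff hm]
    constructor
    · filter_upwards [hkB'] with z hz using hz.1.mul_const _
    · refine (hu.norm.const_mul B).mono' hm.norm.integral_prod_right' ?_
      filter_upwards [hkB'] with z hz
      simp only [norm_mul, integral_mul_const]
      rw [norm_norm, Real.norm_of_nonneg (integral_nonneg fun _ => norm_nonneg _)]
      gcongr
      exact hz.2
  have hG : Integrable (fun p : (ℝ × ℝ) × ℝ => k (p.1.1 - p.2) * u (p.2, p.1.2))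
      ((μ.prod ν).prod μ) := by
    refine (hσ.integrable_comp_of_integrable hH).congr (Eventually.of_forall fun p => ?_)
    simp only [Function.comp_apply, σ]
    rw [← heven, neg_sub]
  refine ⟨hG.prod_right_ae, ?_⟩
  have hF : Integrable (fun p : (ℝ × ℝ) × ℝ => k (p.1.1 - p.2) * u p.1 * g (p.2, p.1.2))
      ((μ.prod ν).prod μ) :=
    hH.mul_bdd (c := M) (by fun_prop) (Eventually.of_forall fun p => hM _)
  have hF' : Integrable (fun p : (ℝ × ℝ) × ℝ => k (p.1.1 - p.2) * u (p.2, p.1.2) * g p.1)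
      ((μ.prod ν).prod μ) :=
    hG.mul_bdd (c := M) (by fun_prop) (Eventually.of_forall fun p => hM _)
  calc ∫ z, (∫ t, k (z.1 - t) * u (t, z.2) ∂μ) * g z ∂(μ.prod ν)
      = ∫ z, (∫ t, k (z.1 - t) * u (t, z.2) * g z ∂μ) ∂(μ.prod ν) := by
        simp only [integral_mul_const]
    _ = ∫ p, k (p.1.1 - p.2) * u (p.2, p.1.2) * g p.1 ∂((μ.prod ν).prod μ) :=
        (integral_prod _ hF').symm
    _ = ∫ p, k (p.1.1 - p.2) * u p.1 * g (p.2, p.1.2) ∂((μ.prod ν).prod μ) := by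
        have := integral_map (μ := (μ.prod ν).prod μ) (φ := σ) hσ.measurable.aemeasurable
          (f := fun p : (ℝ × ℝ) × ℝ => k (p.1.1 - p.2) * u p.1 * g (p.2, p.1.2))
          (by rw [hσ.map_eq]; exact hF.aestronglyMeasurable)
        rw [hσ.map_eq] at this
        rw [this]
        refine integral_congr_ae (Eventually.of_forall fun p => ?_)
        simp only [σ]
        rw [← heven, neg_sub]
    _ = ∫ z, (∫ t, k (z.1 - t) * u z * g (t, z.2) ∂μ) ∂(μ.prod ν) := integral_prod _ hF
    _ = _ := by
        refine integral_congr_ae (Eventually.of_forall fun z => ?_)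
        simp only
        rw [← integral_const_mul]
        congr 1; ext t; ring

end Swap

/-! ### The Riesz derivative as a regularized second difference of the test function -/

section Riesz

variable {a b c d : ℝ}

theorem volume_restrict_rect : (volume : Measure (ℝ × ℝ)).restrict (rect a b c d) =
    (volume.restrict (Ioo a b)).prod (volume.restrict (Ioo c d)) := by
  rw [rect, Measure.volume_eq_prod, Measure.prod_restrict]

theorem leftInt_add_rightInt {α x : ℝ} (hx : x ∈ Ioo a b) {f : ℝ → ℝ}
    (hf : IntegrableOn (fun t => |x - t| ^ (1 - α) * f t) (Ioo a b)) :
    leftInt α a f x + rightInt α b f x =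
      1 / Real.Gamma (2 - α) * ∫ t in Ioo a b, |x - t| ^ (1 - α) * f t := by
  rw [leftInt, rightInt, ← mul_add, intervalIntegral.integral_of_le hx.1.le,
    intervalIntegral.integral_of_le hx.2.le, integral_Ioc_eq_integral_Ioo (x := x) (y := b),
    ← Ioc_union_Ioo_eq_Ioo hx.1.le hx.2, setIntegral_union _ measurableSet_Ioo]
  · congr 2
    · refine setIntegral_congr_fun measurableSet_Ioc fun t ht => ?_
      rw [abs_of_nonneg (by linarith [ht.2])]
    · refine setIntegral_congr_fun measurableSet_Ioo fun t ht => ?_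
      rw [abs_of_neg (by linarith [ht.1]), neg_sub]
  · exact hf.mono_set (Ioc_subset_Ioo_right hx.2)
  · exact hf.mono_set (Ioo_subset_Ioo_left hx.1.le)
  · rw [Set.disjoint_left]
    intro t h1 h2
    exact absurd h1.2 (not_le.2 h2.1)

/-- The test function as a Schwartz function. -/
noncomputable def IsTest.toSchwartz {Ω : Set (ℝ × ℝ)} {φ : ℝ × ℝ → ℝ} (hφ : IsTest Ω φ) :
    SchwartzMap (ℝ × ℝ) ℝ :=
  hφ.compact.toSchwartzMap hφ.smooth

theorem IsTest.slice_smooth {Ω : Set (ℝ × ℝ)} {φ : ℝ × ℝ → ℝ} (hφ : IsTest Ω φ) (y : ℝ) :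
    ContDiff ℝ ∞ fun s => φ (s, y) :=
  hφ.smooth.comp (contDiff_id.prodMk contDiff_const)

theorem IsTest.slice_compact {Ω : Set (ℝ × ℝ)} {φ : ℝ × ℝ → ℝ} (hφ : IsTest Ω φ) (y : ℝ) :
    HasCompactSupport fun s => φ (s, y) := by
  refine HasCompactSupport.intro (hφ.compact.isCompact.image continuous_fst) fun x hx => ?_
  by_contra hcon
  exact hx ⟨(x, y), subset_tsupport _ hcon, rfl⟩

theorem IsTest.iteratedDeriv_slice_eq_zero {φ : ℝ × ℝ → ℝ} (hφ : IsTest (rect a b c d) φ)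
    (y : ℝ) {x : ℝ} (hx : x ∉ Ioo a b) : iteratedDeriv 2 (fun s => φ (s, y)) x = 0 := by
  have hx' : x ∉ tsupport fun s => φ (s, y) := by
    intro hmem
    have hsub : tsupport (fun s => φ (s, y)) ⊆ Prod.fst '' tsupport φ := by
      refine closure_minimal ?_ (hφ.compact.isCompact.image continuous_fst).isClosed
      intro s hs
      exact ⟨(s, y), subset_tsupport _ hs, rfl⟩
    obtain ⟨z, hz, rfl⟩ := hsub hmem
    exact hx (hφ.support_subset hz).1
  rw [iteratedDeriv_succ, iteratedDeriv_one]
  by_contra hcon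
  exact hx' ((closure_minimal support_deriv_subset (isClosed_tsupport _))
    (support_deriv_subset hcon))

/-- Seen as a Schwartz function, the slicewise second derivative is jointly continuous and bounded,
as `integral_kernel_swap` demands. -/
theorem IsTest.iteratedDeriv_slice {Ω : Set (ℝ × ℝ)} {φ : ℝ × ℝ → ℝ} (hφ : IsTest Ω φ)
    (z : ℝ × ℝ) : iteratedDeriv 2 (fun s => φ (s, z.2)) z.1 =
      LineDeriv.lineDerivOp ((1, 0) : ℝ × ℝ)
        (LineDeriv.lineDerivOp ((1, 0) : ℝ × ℝ) hφ.toSchwartz) z := by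
  have hline : ∀ (g : SchwartzMap (ℝ × ℝ) ℝ) (s y : ℝ),
      deriv (fun s : ℝ => g (s, y)) s = LineDeriv.lineDerivOp ((1, 0) : ℝ × ℝ) g (s, y) := by
    intro g s y
    rw [SchwartzMap.lineDerivOp_apply_eq_fderiv]
    have h1 : HasDerivAt (fun s : ℝ => ((s, y) : ℝ × ℝ)) (1, 0) s :=
      (hasDerivAt_id s).prodMk (hasDerivAt_const s y)
    exact ((g.differentiableAt.hasFDerivAt).comp_hasDerivAt s h1).deriv
  rw [iteratedDeriv_succ, iteratedDeriv_one]
  have e1 : deriv (fun s => φ (s, z.2)) = fun s =>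
      LineDeriv.lineDerivOp ((1, 0) : ℝ × ℝ) hφ.toSchwartz (s, z.2) := by
    ext s
    exact hline hφ.toSchwartz s z.2
  rw [e1, hline]

/-- The positive factor relating the Riesz derivative and `fracDiff`. -/
noncomputable def rieszScale (α : ℝ) : ℝ :=
  -1 / (2 * Real.cos (Real.pi * α / 2)) * (1 / Real.Gamma (2 - α)) * (α * (α - 1))

/-- For 1 < α < 2 the angle πα/2 lies in (π/2, π), so the cosine is negative and cancels the sign of
-1. -/
theorem rieszScale_pos {α : ℝ} (hα₁ : 1 < α) (hα₂ : α < 2) : 0 < rieszScale α := by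
  have hcos : Real.cos (Real.pi * α / 2) < 0 := by
    refine Real.cos_neg_of_pi_div_two_lt_of_lt ?_ ?_ <;> nlinarith [Real.pi_pos]
  have hΓ : 0 < Real.Gamma (2 - α) := Real.Gamma_pos_of_pos (by linarith)
  have h1 : 0 < -1 / (2 * Real.cos (Real.pi * α / 2)) :=
    div_pos_of_neg_of_neg (by norm_num) (by linarith)
  have h2 : 0 < α * (α - 1) := by nlinarith
  unfold rieszScale
  positivity

/-- Fubini for the even kernel puts all the analysis on the smooth φ, so `u` need only be
integrable. -/
theorem rieszX_eq {α : ℝ} (hα₁ : 1 < α) (hα₂ : α < 2) {u φ : ℝ × ℝ → ℝ}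
    (hu : IntegrableOn u (rect a b c d)) (hφ : IsTest (rect a b c d) φ) :
    rieszX α a b c d u φ =
      rieszScale α * ∫ z in rect a b c d, u z * fracDiff α ((1, 0) : ℝ × ℝ) φ z := by
  let g : ℝ × ℝ → ℝ := fun z => iteratedDeriv 2 (fun s => φ (s, z.2)) z.1
  let G := LineDeriv.lineDerivOp ((1, 0) : ℝ × ℝ)
        (LineDeriv.lineDerivOp ((1, 0) : ℝ × ℝ) hφ.toSchwartz)
  have hgG : g = G := funext fun z => hφ.iteratedDeriv_slice z
  have hgc : Continuous g := by rw [hgG]; exact G.continuous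
  obtain ⟨M, hM0, hM⟩ := G.decay 0 0
  simp only [pow_zero, one_mul, norm_iteratedFDeriv_zero] at hM
  have hgM : ∀ z, ‖g z‖ ≤ M := fun z => by rw [hgG]; exact hM z
  have hp : -1 < 1 - α := by linarith
  rw [IntegrableOn, volume_restrict_rect] at hu
  obtain ⟨hint, hswap⟩ := integral_kernel_swap (k := fun t => |t| ^ (1 - α)) (by fun_prop)
    (B := ∫ t in Ioc (-(b - a)) (b - a), |t| ^ (1 - α))
    (by
      filter_upwards [ae_restrict_mem measurableSet_Ioo] with x hx
      have := integrableOn_abs_sub_rpow hp hx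
      refine ⟨this.1, ?_⟩
      simp only [Real.norm_eq_abs, abs_of_nonneg (Real.rpow_nonneg (abs_nonneg _) _)]
      exact this.2)
    (fun t => by simp) hu hgc hgM
  have hmem : ∀ᵐ z ∂((volume.restrict (Ioo a b)).prod (volume.restrict (Ioo c d))),
      z ∈ rect a b c d := by
    rw [← volume_restrict_rect]
    exact ae_restrict_mem (measurableSet_Ioo.prod measurableSet_Ioo)
  rw [rieszX, volume_restrict_rect]
  have e1 : ∫ z, (leftInt α a (fun s => u (s, z.2)) z.1 + rightInt α b (fun s => u (s, z.2)) z.1) *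
        iteratedDeriv 2 (fun s => φ (s, z.2)) z.1
          ∂((volume.restrict (Ioo a b)).prod (volume.restrict (Ioo c d))) =
      1 / Real.Gamma (2 - α) * ∫ z, (∫ t in Ioo a b, |z.1 - t| ^ (1 - α) * u (t, z.2)) * g z
          ∂((volume.restrict (Ioo a b)).prod (volume.restrict (Ioo c d))) := by
    rw [← integral_const_mul]
    refine integral_congr_ae ?_
    filter_upwards [hint, hmem] with z hz hzm
    rw [leftInt_add_rightInt hzm.1 hz, mul_assoc]
  -- Since `g` vanishes for t outside (a, b), the integral extends to the whole line, where it can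
  -- be folded about z.1 and integrated by parts.
  have e2 : ∀ z ∈ rect a b c d, ∫ t in Ioo a b, |z.1 - t| ^ (1 - α) * g (t, z.2) =
      α * (α - 1) * fracDiff α ((1, 0) : ℝ × ℝ) φ z := by
    intro z hz
    have h0 : ∀ t, t ∉ Ioo a b → |z.1 - t| ^ (1 - α) * g (t, z.2) = 0 := fun t ht => by
      simp only [g, hφ.iteratedDeriv_slice_eq_zero z.2 ht, mul_zero]
    have hi : Integrable (fun t => |z.1 - t| ^ (1 - α) * g (t, z.2)) := by
      rw [← integrableOn_iff_integrable_of_support_subset (s := Ioo a b)]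
      · exact (integrableOn_abs_sub_rpow hp hz.1).1.mul_bdd (c := M) (by fun_prop)
          (Eventually.of_forall fun t => hgM _)
      · intro t ht
        by_contra hcon
        exact ht (h0 t hcon)
    rw [setIntegral_eq_integral_of_forall_compl_eq_zero h0,
      integral_abs_sub_rpow_mul z.1 (fun t => g (t, z.2)) hi]
    simp only [g]
    rw [integral_rpow_mul_second_difference hα₁ hα₂ (hφ.slice_smooth z.2) (hφ.slice_compact z.2)]
    simp [fracDiff, Prod.add_def, Prod.sub_def]
  rw [e1, hswap]
  have e3 : ∫ z, u z * (∫ t in Ioo a b, |z.1 - t| ^ (1 - α) * g (t, z.2))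
        ∂((volume.restrict (Ioo a b)).prod (volume.restrict (Ioo c d))) =
      α * (α - 1) * ∫ z, u z * fracDiff α ((1, 0) : ℝ × ℝ) φ z
        ∂((volume.restrict (Ioo a b)).prod (volume.restrict (Ioo c d))) := by
    rw [← integral_const_mul]
    refine integral_congr_ae ?_
    filter_upwards [hmem] with z hz
    rw [e2 z hz]
    ring
  rw [e3, rieszScale]
  ring

theorem measurePreserving_swap_rect :
    MeasurePreserving Prod.swap ((volume : Measure (ℝ × ℝ)).restrict (rect a b c d))
      (volume.restrict (rect c d a b)) := by
  rw [volume_restrict_rect, volume_restrict_rect]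
  exact Measure.measurePreserving_swap

theorem IsTest.swap {φ : ℝ × ℝ → ℝ} (hφ : IsTest (rect a b c d) φ) :
    IsTest (rect c d a b) (φ ∘ Prod.swap) where
  smooth := hφ.smooth.comp (contDiff_snd.prodMk contDiff_fst)
  compact := hφ.compact.comp_homeomorph (Homeomorph.prodComm ℝ ℝ)
  support_subset := by
    intro z hz
    have := hφ.support_subset (tsupport_comp_subset_preimage φ continuous_swap hz)
    exact ⟨this.2, this.1⟩

theorem rieszY_eq_rieszX_swap {α : ℝ} (u φ : ℝ × ℝ → ℝ) :
    rieszY α a b c d u φ = rieszX α c d a b (u ∘ Prod.swap) (φ ∘ Prod.swap) := by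
  rw [rieszY, rieszX]
  congr 1
  exact ((measurePreserving_swap_rect (a := c) (b := d) (c := a) (d := b)).integral_comp
    MeasurableEquiv.prodComm.measurableEmbedding _).symm

theorem rieszY_eq {α : ℝ} (hα₁ : 1 < α) (hα₂ : α < 2) {u φ : ℝ × ℝ → ℝ}
    (hu : IntegrableOn u (rect a b c d)) (hφ : IsTest (rect a b c d) φ) :
    rieszY α a b c d u φ =
      rieszScale α * ∫ z in rect a b c d, u z * fracDiff α ((0, 1) : ℝ × ℝ) φ z := by
  rw [rieszY_eq_rieszX_swap, rieszX_eq hα₁ hα₂ _ hφ.swap]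
  · congr 1
    exact ((measurePreserving_swap_rect (a := c) (b := d) (c := a) (d := b)).integral_comp
      MeasurableEquiv.prodComm.measurableEmbedding
      (fun z => u z * fracDiff α ((0, 1) : ℝ × ℝ) φ z)).symm ▸ by
        simp [fracDiff]
  · exact measurePreserving_swap_rect.integrable_comp_of_integrable hu

end Riesz

/-! ### The Fourier multiplier of the fractional second difference -/

section FourierSymbol

variable {V : Type*} [NormedAddCommGroup V] [InnerProductSpace ℝ V] [FiniteDimensional ℝ V]
  [MeasurableSpace V] [BorelSpace V]

theorem integrable_fourierChar_smul {G : V → ℂ} (hG : Integrable G) (x : V) :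
    Integrable fun ξ => Real.fourierChar (inner ℝ ξ x) • G ξ := by
  refine hG.norm.mono' ?_ (Eventually.of_forall fun ξ => by simp)
  have : Continuous fun ξ : V => ((Real.fourierChar (inner ℝ ξ x) : Circle) : ℂ) := by
    have := Real.continuous_fourierChar
    fun_prop
  simp only [Circle.smul_def]
  exact this.aestronglyMeasurable.smul hG.aestronglyMeasurable

theorem SchwartzMap.eq_integral_fourierChar (g : SchwartzMap V ℂ) (x : V) :
    g x = ∫ ξ, Real.fourierChar (inner ℝ ξ x) • 𝓕 g ξ := by
  have h : 𝓕⁻ (𝓕 g) = g := FourierTransform.fourierInv_fourier_eq g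
  conv_lhs => rw [← h, SchwartzMap.fourierInv_coe, Real.fourierInv_eq]

theorem SchwartzMap.second_difference_eq_integral (g : SchwartzMap V ℂ) (e x : V) (h : ℝ) :
    g (x + h • e) + g (x - h • e) - (2 : ℝ) • g x =
      ∫ ξ, Real.fourierChar (inner ℝ ξ x) •
        ((2 * Real.cos (2 * Real.pi * (h * inner ℝ ξ e)) - 2) • 𝓕 g ξ) := by
  have hi := fun y => integrable_fourierChar_smul (𝓕 g).integrable y
  rw [SchwartzMap.eq_integral_fourierChar g (x + h • e),
    SchwartzMap.eq_integral_fourierChar g (x - h • e),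
    SchwartzMap.eq_integral_fourierChar g x, ← integral_add (hi _) (hi _), ← integral_smul,
    ← integral_sub (by exact (hi _).add (hi _)) (by exact (hi x).smul (2 : ℝ))]
  refine integral_congr_ae (Eventually.of_forall fun ξ => ?_)
  simp only [inner_add_right, inner_sub_right, inner_smul_right, Circle.smul_def,
    Real.fourierChar_apply, smul_eq_mul, Complex.real_smul]
  push_cast
  rw [Complex.cos]
  have e1 : Complex.exp (2 * Real.pi * (inner ℝ ξ x + h * inner ℝ ξ e) * Complex.I) =
      Complex.exp (2 * Real.pi * inner ℝ ξ x * Complex.I) *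
        Complex.exp (2 * Real.pi * (h * inner ℝ ξ e) * Complex.I) := by
    rw [← Complex.exp_add]; ring_nf
  have e2 : Complex.exp (2 * Real.pi * (inner ℝ ξ x - h * inner ℝ ξ e) * Complex.I) =
      Complex.exp (2 * Real.pi * inner ℝ ξ x * Complex.I) *
        Complex.exp (-(2 * Real.pi * (h * inner ℝ ξ e)) * Complex.I) := by
    rw [← Complex.exp_add]; ring_nf
  rw [e1, e2]
  ring

theorem abs_rpow_le_one_add_sq {α : ℝ} (hα₁ : 1 < α) (hα₂ : α < 2) (s : ℝ) :
    |s| ^ α ≤ 1 + s ^ 2 := by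
  rcases le_total |s| 1 with h | h
  · have := Real.rpow_le_one (abs_nonneg s) h (by linarith : 0 ≤ α)
    nlinarith [sq_nonneg s]
  · have := Real.rpow_le_rpow_of_exponent_le h hα₂.le
    rw [Real.rpow_two, sq_abs] at this
    linarith

theorem integrable_abs_inner_rpow_smul {α : ℝ} (hα₁ : 1 < α) (hα₂ : α < 2)
    (g : SchwartzMap V ℂ) (e : V) : Integrable fun ξ => (|inner ℝ ξ e| ^ α) • g ξ := by
  have h0 : Integrable fun ξ => ‖g ξ‖ := g.integrable.norm
  have h2 := (g.integrable_pow_mul volume 2).const_mul (‖e‖ ^ 2)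
  refine (h0.add h2).mono' ?_ ?_
  · have : Measurable fun ξ : V => |inner ℝ ξ e| ^ α := by fun_prop
    exact this.aestronglyMeasurable.smul g.continuous.aestronglyMeasurable
  · refine Eventually.of_forall fun ξ => ?_
    rw [norm_smul, Real.norm_of_nonneg (by positivity)]
    have h1 := abs_rpow_le_one_add_sq hα₁ hα₂ (inner ℝ ξ e)
    have h3 : (inner ℝ ξ e) ^ 2 ≤ ‖ξ‖ ^ 2 * ‖e‖ ^ 2 := by
      rw [← sq_abs, ← mul_pow]
      gcongr
      exact abs_real_inner_le_norm ξ e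
    simp only [Pi.add_apply]
    calc |inner ℝ ξ e| ^ α * ‖g ξ‖ ≤ (1 + ‖ξ‖ ^ 2 * ‖e‖ ^ 2) * ‖g ξ‖ := by gcongr; linarith
      _ = _ := by ring

theorem integrableOn_rpow_mul_two_cos_sub_two {α : ℝ} (hα₁ : 1 < α) (hα₂ : α < 2) (s : ℝ) :
    IntegrableOn (fun h : ℝ => h ^ (-1 - α) * (2 - 2 * Real.cos (2 * Real.pi * (h * s))))
      (Ioi 0) := by
  rcases eq_or_ne s 0 with rfl | hs
  · simp
  -- The integral of a non-integrable function is 0 by convention, so the nonzero value computed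
  -- above forces integrability.
  · refine Integrable.of_integral_ne_zero ?_
    rw [integral_rpow_mul_two_sub_two_cos hα₁]
    exact mul_ne_zero (rieszConst_pos hα₁ hα₂).ne' (Real.rpow_pos_of_pos (abs_pos.2 hs) _).ne'

/-- The regularized second difference acts as the Fourier multiplier `-C |⟨ξ, e⟩| ^ α`. -/
theorem SchwartzMap.fracDiff_eq_fourierInv {α : ℝ} (hα₁ : 1 < α) (hα₂ : α < 2)
    (g : SchwartzMap V ℂ) (e : V) :
    fracDiff α e g = 𝓕⁻ fun ξ => (-rieszConst α) • (|inner ℝ ξ e| ^ α) • 𝓕 g ξ := by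
  ext x
  let F : ℝ × V → ℂ := fun p => p.1 ^ (-1 - α) • (Real.fourierChar (inner ℝ p.2 x) •
    ((2 * Real.cos (2 * Real.pi * (p.1 * inner ℝ p.2 e)) - 2) • 𝓕 g p.2))
  have hnorm : ∀ h ξ, 0 < h → ‖F (h, ξ)‖ =
      h ^ (-1 - α) * (2 - 2 * Real.cos (2 * Real.pi * (h * inner ℝ ξ e))) * ‖𝓕 g ξ‖ := by
    intro h ξ hh
    have hc := Real.cos_le_one (2 * Real.pi * (h * inner ℝ ξ e))
    simp only [F, norm_smul, Circle.norm_smul]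
    rw [Real.norm_of_nonneg (by positivity), Real.norm_of_nonpos (by linarith)]
    ring
  have hmeas : AEStronglyMeasurable F ((volume.restrict (Ioi 0)).prod volume) := by
    have h1 : Measurable fun p : ℝ × V => p.1 ^ (-1 - α) := by fun_prop
    have h2 : Continuous fun p : ℝ × V =>
        ((Real.fourierChar (inner ℝ p.2 x) : Circle) : ℂ) • ((2 * Real.cos
          (2 * Real.pi * (p.1 * inner ℝ p.2 e)) - 2) • 𝓕 g p.2) := by
      have := Real.continuous_fourierChar
      have := (𝓕 g).continuous
      fun_prop
    exact h1.aestronglyMeasurable.smul h2.aestronglyMeasurable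
  have e1 : ∀ h ξ, F (h, ξ) = -((h ^ (-1 - α) * (2 - 2 * Real.cos (2 * Real.pi *
      (h * inner ℝ ξ e)))) • (Real.fourierChar (inner ℝ ξ x) • 𝓕 g ξ)) := by
    intro h ξ
    simp only [F, Circle.smul_def, Complex.real_smul, smul_eq_mul]
    push_cast
    ring
  -- For fixed ξ the h-integral of the norm is exactly C |⟨ξ, e⟩|^α ‖ĝ(ξ)‖, with C the constant
  -- `rieszConst`. It is integrable in ξ since ĝ is Schwartz and |s|^α ≤ 1 + s².
  have hF : Integrable F ((volume.restrict (Ioi 0)).prod volume) := by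
    rw [integrable_prod_iff' hmeas]
    constructor
    · refine Eventually.of_forall fun ξ => ?_
      have h1 := (integrableOn_rpow_mul_two_cos_sub_two hα₁ hα₂ (inner ℝ ξ e)).smul_const
        (-(Real.fourierChar (inner ℝ ξ x) • 𝓕 g ξ))
      exact h1.congr (Eventually.of_forall fun h => by simp only [smul_neg, ← e1])
    · have h1 := (integrable_abs_inner_rpow_smul hα₁ hα₂ (𝓕 g) e).norm.const_mul (rieszConst α)
      refine h1.congr (Eventually.of_forall fun ξ => ?_)
      simp only
      rw [setIntegral_congr_fun measurableSet_Ioi fun h hh => hnorm h ξ hh, integral_mul_const,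
        integral_rpow_mul_two_sub_two_cos hα₁, norm_smul, Real.norm_of_nonneg (by positivity)]
      ring
  have hfub := integral_integral_swap (f := fun h ξ => F (h, ξ)) hF
  rw [fracDiff]
  simp only [SchwartzMap.second_difference_eq_integral, ← integral_smul]
  rw [hfub, Real.fourierInv_eq]
  refine integral_congr_ae (Eventually.of_forall fun ξ => ?_)
  simp only [e1]
  rw [integral_neg, integral_smul_const, integral_rpow_mul_two_sub_two_cos hα₁]
  simp only [Circle.smul_def, Complex.real_smul, smul_eq_mul]
  push_cast
  ring

theorem continuous_fourierInv {G : V → ℂ} (hG : Integrable G) : Continuous (𝓕⁻ G) := by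
  have : 𝓕⁻ G = fun w => 𝓕 G (-w) := funext fun w => Real.fourierInv_eq_fourier_neg G w
  rw [this]
  exact (VectorFourier.fourierIntegral_continuous Real.continuous_fourierChar
    (L := innerₗ V) continuous_inner hG).comp continuous_neg

theorem norm_fourierInv_le {G : V → ℂ} (x : V) : ‖𝓕⁻ G x‖ ≤ ∫ ξ, ‖G ξ‖ := by
  rw [Real.fourierInv_eq]
  exact (norm_integral_le_integral_norm _).trans_eq (by simp)

theorem integrable_symbol {α : ℝ} (hα₁ : 1 < α) (hα₂ : α < 2) (g : SchwartzMap V ℂ) (e : V) :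
    Integrable fun ξ => (-rieszConst α) • (|inner ℝ ξ e| ^ α) • 𝓕 g ξ :=
  by exact (integrable_abs_inner_rpow_smul hα₁ hα₂ (𝓕 g) e).smul (-rieszConst α)

/-- The operator is nonlocal, so compact support is lost; continuity, like the bound that follows,
comes from integrability of the symbol times ĝ. -/
theorem SchwartzMap.continuous_fracDiff {α : ℝ} (hα₁ : 1 < α) (hα₂ : α < 2)
    (g : SchwartzMap V ℂ) (e : V) : Continuous (fracDiff α e g) := by
  rw [SchwartzMap.fracDiff_eq_fourierInv hα₁ hα₂]
  exact continuous_fourierInv (integrable_symbol hα₁ hα₂ g e)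

theorem SchwartzMap.exists_norm_fracDiff_le {α : ℝ} (hα₁ : 1 < α) (hα₂ : α < 2)
    (g : SchwartzMap V ℂ) (e : V) : ∃ M, ∀ x, ‖fracDiff α e g x‖ ≤ M := by
  rw [SchwartzMap.fracDiff_eq_fourierInv hα₁ hα₂]
  exact ⟨_, norm_fourierInv_le⟩

/-- The quadratic form of the regularized second difference on the Fourier side. -/
theorem SchwartzMap.integral_inner_fracDiff {α : ℝ} (hα₁ : 1 < α) (hα₂ : α < 2)
    (f g : SchwartzMap V ℂ) (e : V) :
    ∫ x, inner ℂ (f x) (fracDiff α e g x) =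
      -rieszConst α * ∫ ξ, (|inner ℝ ξ e| ^ α : ℝ) * inner ℂ (𝓕 f ξ) (𝓕 g ξ) := by
  -- This form of Parseval needs only integrability of `f` and of the symbol times ĝ, so `fracDiff α
  -- e g` need not be shown to lie in L².
  have h := VectorFourier.integral_sesq_fourierIntegral_eq_neg_flip (innerSL ℂ (E := ℂ))
    (L := innerₗ V) Real.continuous_fourierChar continuous_inner (f.integrable (μ := volume))
    (integrable_symbol hα₁ hα₂ g e)
  rw [SchwartzMap.fracDiff_eq_fourierInv hα₁ hα₂, ← integral_const_mul]
  have h2 : ∀ x, VectorFourier.fourierIntegral Real.fourierChar volume (-(innerₗ V).flip)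
      (fun ξ => (-rieszConst α) • (|inner ℝ ξ e| ^ α) • 𝓕 g ξ) x =
      𝓕⁻ (fun ξ => (-rieszConst α) • (|inner ℝ ξ e| ^ α) • 𝓕 g ξ) x := by
    intro x
    rw [Real.fourierInv_eq, VectorFourier.fourierIntegral]
    simp
  simp only [h2] at h
  refine Eq.trans h.symm (integral_congr_ae (Eventually.of_forall fun ξ => ?_))
  simp only [innerSL_apply_apply]
  change inner ℂ (𝓕 f ξ) _ = _
  simp only [RCLike.inner_apply, Complex.real_smul]
  push_cast
  ring

end FourierSymbol

/-! ### Transfer to the Euclidean plane and the bilinear form -/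

section Plane

/-- The identification of the Euclidean plane with `ℝ × ℝ`. -/
noncomputable def toPlane : EuclideanSpace ℝ (Fin 2) ≃L[ℝ] ℝ × ℝ :=
  (EuclideanSpace.equiv (Fin 2) ℝ).trans (ContinuousLinearEquiv.finTwoArrow ℝ ℝ)

@[simp]
theorem toPlane_apply (z : EuclideanSpace ℝ (Fin 2)) : toPlane z = (z 0, z 1) := rfl

theorem inner_single_one (ξ : EuclideanSpace ℝ (Fin 2)) (i : Fin 2) :
    inner ℝ ξ (EuclideanSpace.single i (1 : ℝ)) = ξ i := by
  rw [EuclideanSpace.inner_single_right]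
  simp

theorem measurePreserving_toPlane : MeasurePreserving toPlane :=
  (volume_preserving_finTwoArrow ℝ).comp (PiLp.volume_preserving_ofLp (Fin 2))

theorem measurableEmbedding_toPlane : MeasurableEmbedding toPlane :=
  toPlane.toHomeomorph.measurableEmbedding

variable {Ω : Set (ℝ × ℝ)} {φ ψ : ℝ × ℝ → ℝ}

/-- A test function as a complex-valued Schwartz function on the Euclidean plane. -/
noncomputable def IsTest.euclid (hφ : IsTest Ω φ) : SchwartzMap (EuclideanSpace ℝ (Fin 2)) ℂ :=
  HasCompactSupport.toSchwartzMap (f := fun z => ((φ (toPlane z) : ℝ) : ℂ))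
    ((hφ.compact.comp_homeomorph toPlane.toHomeomorph).comp_left
      (g := ((↑) : ℝ → ℂ)) Complex.ofReal_zero)
    (Complex.ofRealCLM.contDiff.comp (hφ.smooth.comp toPlane.contDiff))

theorem IsTest.euclid_apply (hφ : IsTest Ω φ) (z : EuclideanSpace ℝ (Fin 2)) :
    hφ.euclid z = ((φ (toPlane z) : ℝ) : ℂ) := rfl

theorem IsTest.eq_zero (hφ : IsTest Ω φ) {z : ℝ × ℝ} (hz : z ∉ Ω) : φ z = 0 := by
  by_contra hcon
  exact hz (hφ.support_subset (subset_tsupport _ hcon))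

theorem IsTest.indicator_eq (hφ : IsTest Ω φ) : Ω.indicator φ = φ := by
  rw [indicator_eq_self]
  exact (subset_tsupport _).trans hφ.support_subset

theorem IsTest.fourierZeroExt_eq (hφ : IsTest Ω φ) :
    fourierZeroExt Ω φ = 𝓕 hφ.euclid := by
  rw [SchwartzMap.fourier_coe, fourierZeroExt, hφ.indicator_eq]
  rfl

theorem IsTest.fracDiff_euclid (hφ : IsTest Ω φ) (α : ℝ) (e z : EuclideanSpace ℝ (Fin 2)) :
    fracDiff α e hφ.euclid z = ((fracDiff α (toPlane e) φ (toPlane z) : ℝ) : ℂ) := by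
  rw [fracDiff, fracDiff, ← integral_complex_ofReal]
  refine integral_congr_ae (Eventually.of_forall fun h => ?_)
  simp only [IsTest.euclid_apply, map_add, map_sub, map_smul, Complex.real_smul, smul_eq_mul]
  push_cast
  rfl

theorem IsTest.memLp (hφ : IsTest Ω φ) (p : ℝ≥0∞) (μ : Measure (ℝ × ℝ))
    [IsFiniteMeasureOnCompacts μ] : MemLp φ p μ :=
  hφ.smooth.continuous.memLp_of_hasCompactSupport hφ.compact

theorem IsTest.continuous_fracDiff (hφ : IsTest Ω φ) {α : ℝ} (hα₁ : 1 < α) (hα₂ : α < 2)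
    (e : ℝ × ℝ) : Continuous (fracDiff α e φ) := by
  have h := (SchwartzMap.continuous_fracDiff hα₁ hα₂ hφ.euclid (toPlane.symm e)).comp
    toPlane.symm.continuous
  have h2 : fracDiff α e φ = fun z =>
      (fracDiff α (toPlane.symm e) hφ.euclid (toPlane.symm z)).re := by
    ext z
    rw [hφ.fracDiff_euclid, Complex.ofReal_re, toPlane.apply_symm_apply,
      toPlane.apply_symm_apply]
  rw [h2]
  exact Complex.continuous_re.comp h

theorem IsTest.exists_norm_fracDiff_le (hφ : IsTest Ω φ) {α : ℝ} (hα₁ : 1 < α) (hα₂ : α < 2)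
    (e : ℝ × ℝ) : ∃ M, ∀ z, ‖fracDiff α e φ z‖ ≤ M := by
  obtain ⟨M, hM⟩ := SchwartzMap.exists_norm_fracDiff_le hα₁ hα₂ hφ.euclid (toPlane.symm e)
  refine ⟨M, fun z => ?_⟩
  have := hM (toPlane.symm z)
  rwa [hφ.fracDiff_euclid, Complex.norm_real, toPlane.apply_symm_apply,
    toPlane.apply_symm_apply] at this

/-- The fractional operator applied to a test function. -/
noncomputable def rieszOp (κ₁ κ₂ α : ℝ) (φ : ℝ × ℝ → ℝ) (z : ℝ × ℝ) : ℝ :=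
  rieszScale α * (κ₁ * fracDiff α ((1, 0) : ℝ × ℝ) φ z + κ₂ * fracDiff α ((0, 1) : ℝ × ℝ) φ z)

/-- The Fourier symbol of minus the fractional operator. -/
noncomputable def rieszSymbol (κ₁ κ₂ α : ℝ) (ξ : EuclideanSpace ℝ (Fin 2)) : ℝ :=
  rieszScale α * rieszConst α * (κ₁ * |ξ 0| ^ α + κ₂ * |ξ 1| ^ α)

theorem IsTest.continuous_rieszOp (hφ : IsTest Ω φ) (κ₁ κ₂ : ℝ) {α : ℝ} (hα₁ : 1 < α)
    (hα₂ : α < 2) : Continuous (rieszOp κ₁ κ₂ α φ) := by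
  have h1 := hφ.continuous_fracDiff hα₁ hα₂ (1, 0)
  have h2 := hφ.continuous_fracDiff hα₁ hα₂ (0, 1)
  unfold rieszOp
  fun_prop

theorem IsTest.memLp_rieszOp (hφ : IsTest Ω φ) (κ₁ κ₂ : ℝ) {α : ℝ} (hα₁ : 1 < α)
    (hα₂ : α < 2) (μ : Measure (ℝ × ℝ)) [IsFiniteMeasure μ] :
    MemLp (rieszOp κ₁ κ₂ α φ) 2 μ := by
  obtain ⟨M₁, h₁⟩ := hφ.exists_norm_fracDiff_le hα₁ hα₂ (1, 0)
  obtain ⟨M₂, h₂⟩ := hφ.exists_norm_fracDiff_le hα₁ hα₂ (0, 1)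
  refine MemLp.of_bound (hφ.continuous_rieszOp κ₁ κ₂ hα₁ hα₂).aestronglyMeasurable
    (‖rieszScale α‖ * (‖κ₁‖ * M₁ + ‖κ₂‖ * M₂)) (Eventually.of_forall fun z => ?_)
  rw [rieszOp, norm_mul]
  gcongr
  refine (norm_add_le _ _).trans ?_
  rw [norm_mul, norm_mul]
  gcongr
  · exact h₁ z
  · exact h₂ z

theorem integral_mul_fracDiff {α : ℝ} (hα₁ : 1 < α) (hα₂ : α < 2)
    (hψ : IsTest Ω ψ) (hφ : IsTest Ω φ) (e : EuclideanSpace ℝ (Fin 2)) :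
    ∫ z, ψ z * fracDiff α (toPlane e) φ z =
      -rieszConst α * ∫ ξ, |inner ℝ ξ e| ^ α *
        inner ℝ (fourierZeroExt Ω ψ ξ) (fourierZeroExt Ω φ ξ) := by
  have h := congrArg Complex.re
    (SchwartzMap.integral_inner_fracDiff hα₁ hα₂ hψ.euclid hφ.euclid e)
  have hl : ∀ x, inner ℂ (hψ.euclid x) (fracDiff α e hφ.euclid x) =
      ((ψ (toPlane x) * fracDiff α (toPlane e) φ (toPlane x) : ℝ) : ℂ) := by
    intro x
    rw [hφ.fracDiff_euclid, hψ.euclid_apply, RCLike.inner_apply, RCLike.conj_eq_re_sub_im]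
    simp
    ring
  simp only [hl] at h
  rw [integral_complex_ofReal, Complex.ofReal_re, measurePreserving_toPlane.integral_comp
    measurableEmbedding_toPlane (fun z => ψ z * fracDiff α (toPlane e) φ z)] at h
  rw [h, ← Complex.ofReal_neg, Complex.re_ofReal_mul, hψ.fourierZeroExt_eq, hφ.fourierZeroExt_eq]
  congr 1
  have hint : Integrable fun ξ => ((|inner ℝ ξ e| ^ α : ℝ) : ℂ) *
      inner ℂ (𝓕 hψ.euclid ξ) (𝓕 hφ.euclid ξ) := by
    obtain ⟨M, -, hM⟩ := (𝓕 hψ.euclid).decay 0 0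
    simp only [pow_zero, one_mul, norm_iteratedFDeriv_zero] at hM
    have := (integrable_abs_inner_rpow_smul hα₁ hα₂ (𝓕 hφ.euclid) e).mul_bdd (c := M)
      (g := fun ξ => starRingEnd ℂ (𝓕 hψ.euclid ξ))
      (Complex.continuous_conj.comp (𝓕 hψ.euclid).continuous).aestronglyMeasurable
      (Eventually.of_forall fun ξ => by simpa using hM ξ)
    refine this.congr (Eventually.of_forall fun ξ => ?_)
    simp only [RCLike.inner_apply, Complex.real_smul]
    ring
  have hre := integral_re hint
  simp only [RCLike.re_to_complex] at hre
  rw [← hre]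
  refine integral_congr_ae (Eventually.of_forall fun ξ => ?_)
  simp only [Complex.re_ofReal_mul]
  rw [Complex.inner, RCLike.inner_apply]

theorem integrable_abs_inner_mul_inner {α : ℝ} (hα₁ : 1 < α) (hα₂ : α < 2)
    (hψ : IsTest Ω ψ) (hφ : IsTest Ω φ) (e : EuclideanSpace ℝ (Fin 2)) :
    Integrable fun ξ => |inner ℝ ξ e| ^ α *
        inner ℝ (fourierZeroExt Ω ψ ξ) (fourierZeroExt Ω φ ξ) := by
  rw [hψ.fourierZeroExt_eq, hφ.fourierZeroExt_eq]
  obtain ⟨M, -, hM⟩ := (𝓕 hψ.euclid).decay 0 0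
  simp only [pow_zero, one_mul, norm_iteratedFDeriv_zero] at hM
  refine ((integrable_abs_inner_rpow_smul hα₁ hα₂ (𝓕 hφ.euclid) e).norm.const_mul M).mono' ?_ ?_
  · have h1 : Measurable fun ξ : EuclideanSpace ℝ (Fin 2) => |inner ℝ ξ e| ^ α := by fun_prop
    have h2 : Continuous fun ξ => inner ℝ (𝓕 hψ.euclid ξ) (𝓕 hφ.euclid ξ) :=
      (𝓕 hψ.euclid).continuous.inner (𝓕 hφ.euclid).continuous
    exact h1.aestronglyMeasurable.mul h2.aestronglyMeasurable
  · refine Eventually.of_forall fun ξ => ?_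
    rw [norm_mul, norm_smul]
    have := norm_inner_le_norm (𝕜 := ℝ) (𝓕 hψ.euclid ξ) (𝓕 hφ.euclid ξ)
    calc _ ≤ ‖|inner ℝ ξ e| ^ α‖ * (M * ‖𝓕 hφ.euclid ξ‖) := by
          gcongr
          refine this.trans ?_
          gcongr
          exact hM ξ
      _ = _ := by ring

/-- The bilinear form of the fractional operator on the Fourier side. -/
theorem integral_mul_rieszOp {α : ℝ} (hα₁ : 1 < α) (hα₂ : α < 2) (κ₁ κ₂ : ℝ)
    (hψ : IsTest Ω ψ) (hφ : IsTest Ω φ) :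
    ∫ z in Ω, ψ z * rieszOp κ₁ κ₂ α φ z =
      -∫ ξ, rieszSymbol κ₁ κ₂ α ξ *
        inner ℝ (fourierZeroExt Ω ψ ξ) (fourierZeroExt Ω φ ξ) := by
  -- The operator applied to φ need not vanish outside Ω, but ψ does; the integral is thus over the
  -- whole plane and Parseval applies.
  rw [setIntegral_eq_integral_of_forall_compl_eq_zero
    (fun z hz => by rw [hψ.eq_zero hz, zero_mul])]
  have hi : ∀ e : ℝ × ℝ, Integrable fun z => ψ z * fracDiff α e φ z := by
    intro e
    obtain ⟨M, hM⟩ := hφ.exists_norm_fracDiff_le hα₁ hα₂ e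
    exact (memLp_one_iff_integrable.1 (hψ.memLp 1 volume)).mul_bdd (c := M)
      (hφ.continuous_fracDiff hα₁ hα₂ e).aestronglyMeasurable (Eventually.of_forall hM)
  have h0 := integral_mul_fracDiff hα₁ hα₂ hψ hφ (EuclideanSpace.single 0 (1 : ℝ))
  have h1 := integral_mul_fracDiff hα₁ hα₂ hψ hφ (EuclideanSpace.single 1 (1 : ℝ))
  have j0 := integrable_abs_inner_mul_inner hα₁ hα₂ hψ hφ (EuclideanSpace.single 0 (1 : ℝ))
  have j1 := integrable_abs_inner_mul_inner hα₁ hα₂ hψ hφ (EuclideanSpace.single 1 (1 : ℝ))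
  have t0 : toPlane (EuclideanSpace.single 0 (1 : ℝ)) = (1, 0) := by simp
  have t1 : toPlane (EuclideanSpace.single 1 (1 : ℝ)) = (0, 1) := by simp
  simp only [inner_single_one, t0, t1] at h0 h1 j0 j1
  have hl : ∀ z, ψ z * rieszOp κ₁ κ₂ α φ z =
      rieszScale α * κ₁ * (ψ z * fracDiff α ((1, 0) : ℝ × ℝ) φ z) +
      rieszScale α * κ₂ * (ψ z * fracDiff α ((0, 1) : ℝ × ℝ) φ z) := fun z => by
    rw [rieszOp]; ring
  have hr : ∀ ξ, rieszSymbol κ₁ κ₂ α ξ *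
        inner ℝ (fourierZeroExt Ω ψ ξ) (fourierZeroExt Ω φ ξ) =
      rieszScale α * rieszConst α * κ₁ *
        (|ξ 0| ^ α * inner ℝ (fourierZeroExt Ω ψ ξ) (fourierZeroExt Ω φ ξ)) +
      rieszScale α * rieszConst α * κ₂ *
        (|ξ 1| ^ α * inner ℝ (fourierZeroExt Ω ψ ξ) (fourierZeroExt Ω φ ξ)) := fun ξ => by
    rw [rieszSymbol]; ring
  simp only [hl, hr]
  rw [integral_add ((hi _).const_mul _) ((hi _).const_mul _),
    integral_add (j0.const_mul _) (j1.const_mul _)]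
  simp only [integral_const_mul]
  rw [h0, h1]
  ring

theorem integrable_rieszSymbol_mul {α : ℝ} (hα₁ : 1 < α) (hα₂ : α < 2) (κ₁ κ₂ : ℝ)
    (hψ : IsTest Ω ψ) (hφ : IsTest Ω φ) :
    Integrable fun ξ => rieszSymbol κ₁ κ₂ α ξ *
        inner ℝ (fourierZeroExt Ω ψ ξ) (fourierZeroExt Ω φ ξ) := by
  have j0 := integrable_abs_inner_mul_inner hα₁ hα₂ hψ hφ (EuclideanSpace.single 0 (1 : ℝ))
  have j1 := integrable_abs_inner_mul_inner hα₁ hα₂ hψ hφ (EuclideanSpace.single 1 (1 : ℝ))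
  refine ((j0.const_mul (rieszScale α * rieszConst α * κ₁)).add
    (j1.const_mul (rieszScale α * rieszConst α * κ₂))).congr (Eventually.of_forall fun ξ => ?_)
  simp only [rieszSymbol, inner_single_one, Pi.add_apply]
  ring

theorem weak_form_eq {a b c d α : ℝ} (hα₁ : 1 < α) (hα₂ : α < 2) (κ₁ κ₂ : ℝ) {u : ℝ × ℝ → ℝ}
    (hu : IntegrableOn u (rect a b c d)) (hφ : IsTest (rect a b c d) φ) :
    κ₁ * rieszX α a b c d u φ + κ₂ * rieszY α a b c d u φ =
      ∫ z in rect a b c d, u z * rieszOp κ₁ κ₂ α φ z := by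
  have hi : ∀ e : ℝ × ℝ, IntegrableOn (fun z => u z * fracDiff α e φ z) (rect a b c d) := by
    intro e
    obtain ⟨M, hM⟩ := hφ.exists_norm_fracDiff_le hα₁ hα₂ e
    exact hu.mul_bdd (c := M)
      (hφ.continuous_fracDiff hα₁ hα₂ e).aestronglyMeasurable (Eventually.of_forall hM)
  have hl : ∀ z, u z * rieszOp κ₁ κ₂ α φ z =
      rieszScale α * κ₁ * (u z * fracDiff α ((1, 0) : ℝ × ℝ) φ z) +
      rieszScale α * κ₂ * (u z * fracDiff α ((0, 1) : ℝ × ℝ) φ z) := fun z => by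
    rw [rieszOp]; ring
  simp only [hl]
  rw [integral_add ((hi _).const_mul _) ((hi _).const_mul _), integral_const_mul,
    integral_const_mul, rieszX_eq hα₁ hα₂ hu hφ, rieszY_eq hα₁ hα₂ hu hφ]
  ring

end Plane

/-! ### Ellipticity of the symbol -/

section Symbol

variable {κ₁ κ₂ α : ℝ}

theorem rieszSymbol_nonneg (hκ₁ : 0 < κ₁) (hκ₂ : 0 < κ₂) (hα₁ : 1 < α) (hα₂ : α < 2)
    (ξ : EuclideanSpace ℝ (Fin 2)) : 0 ≤ rieszSymbol κ₁ κ₂ α ξ := by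
  have := rieszScale_pos hα₁ hα₂
  have := rieszConst_pos hα₁ hα₂
  unfold rieszSymbol
  positivity

@[fun_prop]
theorem measurable_rieszSymbol : Measurable (rieszSymbol κ₁ κ₂ α) := by
  unfold rieszSymbol
  fun_prop

theorem exists_le_rieszSymbol (hκ₁ : 0 < κ₁) (hκ₂ : 0 < κ₂) (hα₁ : 1 < α) (hα₂ : α < 2) :
    ∃ m, 0 < m ∧ ∀ ξ, m * ‖ξ‖ ^ α ≤ rieszSymbol κ₁ κ₂ α ξ := by
  have hs := rieszScale_pos hα₁ hα₂
  have hc := rieszConst_pos hα₁ hα₂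
  have hmin : 0 < min κ₁ κ₂ := lt_min hκ₁ hκ₂
  -- The factor 2^α comes from the crude bound ‖ξ‖ ≤ 2 max(|ξ₀|, |ξ₁|).
  refine ⟨rieszScale α * rieszConst α * min κ₁ κ₂ * (2 ^ α)⁻¹, by positivity, fun ξ => ?_⟩
  have hle : ‖ξ‖ ^ α ≤ 2 ^ α * (|ξ 0| ^ α + |ξ 1| ^ α) := by
    have hn : ‖ξ‖ ≤ 2 * max |ξ 0| |ξ 1| := by
      have h0 : 0 ≤ max |ξ 0| |ξ 1| := le_max_of_le_left (abs_nonneg _)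
      refine abs_le_of_sq_le_sq' ?_ (by positivity) |>.2
      rw [EuclideanSpace.real_norm_sq_eq, Fin.sum_univ_two]
      have h1 : ξ 0 ^ 2 ≤ (max |ξ 0| |ξ 1|) ^ 2 := by
        rw [← sq_abs]; gcongr; exact le_max_left _ _
      have h2 : ξ 1 ^ 2 ≤ (max |ξ 0| |ξ 1|) ^ 2 := by
        rw [← sq_abs]; gcongr; exact le_max_right _ _
      nlinarith
    calc ‖ξ‖ ^ α ≤ (2 * max |ξ 0| |ξ 1|) ^ α :=
          Real.rpow_le_rpow (norm_nonneg _) hn (by linarith)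
      _ = 2 ^ α * (max |ξ 0| |ξ 1|) ^ α :=
          Real.mul_rpow (by norm_num) (le_max_of_le_left (abs_nonneg _))
      _ ≤ _ := by
          gcongr
          have p0 : 0 ≤ |ξ 0| ^ α := by positivity
          have p1 : 0 ≤ |ξ 1| ^ α := by positivity
          rcases max_choice |ξ 0| |ξ 1| with h | h <;> rw [h] <;> linarith
  have h2 : (0 : ℝ) < 2 ^ α := by positivity
  calc rieszScale α * rieszConst α * min κ₁ κ₂ * (2 ^ α)⁻¹ * ‖ξ‖ ^ α
      ≤ rieszScale α * rieszConst α * min κ₁ κ₂ * (2 ^ α)⁻¹ *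
        (2 ^ α * (|ξ 0| ^ α + |ξ 1| ^ α)) := by gcongr
    _ = rieszScale α * rieszConst α * (min κ₁ κ₂ * |ξ 0| ^ α + min κ₁ κ₂ * |ξ 1| ^ α) := by
        field_simp
    _ ≤ rieszSymbol κ₁ κ₂ α ξ := by
        unfold rieszSymbol
        gcongr
        · exact min_le_left _ _
        · exact min_le_right _ _

theorem exists_rieszSymbol_le (hκ₁ : 0 < κ₁) (hκ₂ : 0 < κ₂) (hα₁ : 1 < α) (hα₂ : α < 2) :
    ∃ M, 0 < M ∧ ∀ ξ, rieszSymbol κ₁ κ₂ α ξ ≤ M * ‖ξ‖ ^ α := by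
  have hs := rieszScale_pos hα₁ hα₂
  have hc := rieszConst_pos hα₁ hα₂
  refine ⟨rieszScale α * rieszConst α * (κ₁ + κ₂), by positivity, fun ξ => ?_⟩
  have h : ∀ i, |ξ i| ≤ ‖ξ‖ := PiLp.norm_apply_le ξ
  calc rieszSymbol κ₁ κ₂ α ξ
      ≤ rieszScale α * rieszConst α * (κ₁ * ‖ξ‖ ^ α + κ₂ * ‖ξ‖ ^ α) := by
        unfold rieszSymbol
        gcongr
        · exact h 0
        · exact h 1
    _ = _ := by ring

end Symbol

/-! ### Fourier transform of the extension by zero -/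

section ZeroExtension

variable {Ω : Set (ℝ × ℝ)} {u v : ℝ × ℝ → ℝ}

theorem integrable_zeroExt (hΩ : MeasurableSet Ω) (hu : IntegrableOn u Ω) :
    Integrable fun z : EuclideanSpace ℝ (Fin 2) => ((Ω.indicator u (z 0, z 1) : ℝ) : ℂ) :=
  (measurePreserving_toPlane.integrable_comp_of_integrable
    ((integrable_indicator_iff hΩ).2 hu)).ofReal

theorem continuous_fourierZeroExt (hΩ : MeasurableSet Ω) (hu : IntegrableOn u Ω) :
    Continuous (fourierZeroExt Ω u) :=
  VectorFourier.fourierIntegral_continuous Real.continuous_fourierChar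
    (L := innerₗ (EuclideanSpace ℝ (Fin 2))) continuous_inner (integrable_zeroExt hΩ hu)

theorem norm_fourierZeroExt_le (hΩ : MeasurableSet Ω) (u : ℝ × ℝ → ℝ)
    (ξ : EuclideanSpace ℝ (Fin 2)) : ‖fourierZeroExt Ω u ξ‖ ≤ ∫ z in Ω, ‖u z‖ := by
  refine (VectorFourier.norm_fourierIntegral_le_integral_norm _ _ _ _ _).trans_eq ?_
  rw [← integral_indicator hΩ, ← measurePreserving_toPlane.integral_comp
    measurableEmbedding_toPlane]
  simp only [Complex.norm_real, norm_indicator_eq_indicator_norm]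
  rfl

theorem integrable_fourier_integrand (hΩ : MeasurableSet Ω) (hu : IntegrableOn u Ω)
    (ξ : EuclideanSpace ℝ (Fin 2)) :
    Integrable fun z : EuclideanSpace ℝ (Fin 2) =>
      Real.fourierChar (-inner ℝ z ξ) • ((Ω.indicator u (z 0, z 1) : ℝ) : ℂ) := by
  have := integrable_fourierChar_smul (integrable_zeroExt hΩ hu) (-ξ)
  simpa only [inner_neg_right] using this

theorem fourierZeroExt_add (hΩ : MeasurableSet Ω) (hu : IntegrableOn u Ω)
    (hv : IntegrableOn v Ω) :
    fourierZeroExt Ω (u + v) = fourierZeroExt Ω u + fourierZeroExt Ω v := by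
  ext ξ
  simp only [fourierZeroExt, Pi.add_apply, Real.fourier_eq]
  rw [← integral_add (integrable_fourier_integrand hΩ hu ξ)
    (integrable_fourier_integrand hΩ hv ξ)]
  simp only [indicator_add', Pi.add_apply, Complex.ofReal_add, smul_add]

theorem fourierZeroExt_smul (r : ℝ) :
    fourierZeroExt Ω (r • u) = r • fourierZeroExt Ω u := by
  ext ξ
  simp only [fourierZeroExt, Pi.smul_apply, Real.fourier_eq]
  rw [← integral_smul]
  refine integral_congr_ae (Eventually.of_forall fun z => ?_)
  simp only [smul_eq_mul, Circle.smul_def, Complex.real_smul]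
  have : Ω.indicator (r • u) (z 0, z 1) = r * Ω.indicator u (z 0, z 1) := by
    by_cases h : (z 0, z 1) ∈ Ω <;> simp [h]
  rw [this]
  push_cast
  ring

theorem fourierZeroExt_sub (hΩ : MeasurableSet Ω) (hu : IntegrableOn u Ω)
    (hv : IntegrableOn v Ω) :
    fourierZeroExt Ω (u - v) = fourierZeroExt Ω u - fourierZeroExt Ω v := by
  have h : u - v = u + (-1 : ℝ) • v := by simp [sub_eq_add_neg]
  rw [h, fourierZeroExt_add hΩ hu (hv.smul (-1 : ℝ)), fourierZeroExt_smul]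
  simp [sub_eq_add_neg]

end ZeroExtension

/-! ### Energy norm and Poincaré inequality -/

section EnergySpace

/-- The test functions on `Ω`. -/
def testSpace (Ω : Set (ℝ × ℝ)) : Submodule ℝ (ℝ × ℝ → ℝ) where
  carrier := {φ | IsTest Ω φ}
  zero_mem' := ⟨contDiff_const, HasCompactSupport.zero, by simp [tsupport]⟩
  add_mem' := fun h₁ h₂ => ⟨h₁.smooth.add h₂.smooth, h₁.compact.add h₂.compact,
    (tsupport_add _ _).trans (union_subset h₁.support_subset h₂.support_subset)⟩
  smul_mem' := fun c _ h => ⟨contDiff_const.smul h.smooth, h.compact.smul_left (f := fun _ => c),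
    (tsupport_smul_subset_right (fun _ => c) _).trans h.support_subset⟩

variable (κ₁ κ₂ α : ℝ) (Ω : Set (ℝ × ℝ))

/-- The Fourier transform of the zero extension weighted by the square root of the symbol. -/
noncomputable def energyTransform (u : ℝ × ℝ → ℝ) (ξ : EuclideanSpace ℝ (Fin 2)) : ℂ :=
  (√(rieszSymbol κ₁ κ₂ α ξ) : ℂ) * fourierZeroExt Ω u ξ

variable {κ₁ κ₂ α Ω} {u v φ ψ : ℝ × ℝ → ℝ}

theorem aestronglyMeasurable_energyTransform (hΩ : MeasurableSet Ω) (hu : IntegrableOn u Ω) :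
    AEStronglyMeasurable (energyTransform κ₁ κ₂ α Ω u) := by
  have h1 : Measurable fun ξ => ((√(rieszSymbol κ₁ κ₂ α ξ) : ℝ) : ℂ) := by fun_prop
  exact h1.aestronglyMeasurable.mul (continuous_fourierZeroExt hΩ hu).aestronglyMeasurable

theorem inner_energyTransform (hκ₁ : 0 < κ₁) (hκ₂ : 0 < κ₂) (hα₁ : 1 < α) (hα₂ : α < 2)
    (ξ : EuclideanSpace ℝ (Fin 2)) :
    inner ℝ (energyTransform κ₁ κ₂ α Ω u ξ) (energyTransform κ₁ κ₂ α Ω v ξ) =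
      rieszSymbol κ₁ κ₂ α ξ * inner ℝ (fourierZeroExt Ω u ξ) (fourierZeroExt Ω v ξ) := by
  simp only [energyTransform, ← Complex.real_smul]
  rw [real_inner_smul_left, real_inner_smul_right, ← mul_assoc,
    Real.mul_self_sqrt (rieszSymbol_nonneg hκ₁ hκ₂ hα₁ hα₂ ξ)]

theorem IsTest.integrableOn (hφ : IsTest Ω φ) : IntegrableOn φ Ω :=
  (memLp_one_iff_integrable.1 (hφ.memLp 1 volume)).integrableOn

theorem IsTest.memLp_energyTransform (hφ : IsTest Ω φ) (hΩ : MeasurableSet Ω)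
    (hκ₁ : 0 < κ₁) (hκ₂ : 0 < κ₂) (hα₁ : 1 < α) (hα₂ : α < 2) :
    MemLp (energyTransform κ₁ κ₂ α Ω φ) 2 volume := by
  rw [memLp_two_iff_integrable_sq_norm
    (aestronglyMeasurable_energyTransform hΩ hφ.integrableOn)]
  refine (integrable_rieszSymbol_mul hα₁ hα₂ κ₁ κ₂ hφ hφ).congr
    (Eventually.of_forall fun ξ => ?_)
  simp only
  rw [← inner_energyTransform hκ₁ hκ₂ hα₁ hα₂, real_inner_self_eq_norm_sq]

/-- Pointwise square root of the symbol bound. Values in [0, ∞] allow its use before either side is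
known to be finite; the same holds for the converse below. -/
theorem exists_energyTransform_le (hκ₁ : 0 < κ₁) (hκ₂ : 0 < κ₂) (hα₁ : 1 < α) (hα₂ : α < 2) :
    ∃ C : ℝ, ∀ (Ω : Set (ℝ × ℝ)) (u : ℝ × ℝ → ℝ),
      eLpNorm (energyTransform κ₁ κ₂ α Ω u) 2 volume ≤
        ENNReal.ofReal C * sobolevSeminorm (α / 2) Ω u := by
  obtain ⟨M, hM0, hM⟩ := exists_rieszSymbol_le hκ₁ hκ₂ hα₁ hα₂
  refine ⟨√M, fun Ω u => eLpNorm_le_mul_eLpNorm_of_ae_le_mul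
    (Eventually.of_forall fun ξ => ?_) 2⟩
  have h1 : √(rieszSymbol κ₁ κ₂ α ξ) ≤ √M * ‖ξ‖ ^ (α / 2) := by
    refine (Real.sqrt_le_sqrt (hM ξ)).trans_eq ?_
    rw [Real.sqrt_mul hM0.le, Real.sqrt_eq_rpow (‖ξ‖ ^ α), ← Real.rpow_mul (norm_nonneg _)]
    ring_nf
  rw [energyTransform, norm_mul, norm_mul, Complex.norm_real, Complex.norm_real,
    Real.norm_of_nonneg (Real.sqrt_nonneg _), Real.norm_of_nonneg (by positivity), ← mul_assoc]
  gcongr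

theorem exists_sobolevSeminorm_le (hκ₁ : 0 < κ₁) (hκ₂ : 0 < κ₂) (hα₁ : 1 < α) (hα₂ : α < 2) :
    ∃ C : ℝ, ∀ (Ω : Set (ℝ × ℝ)) (u : ℝ × ℝ → ℝ),
      sobolevSeminorm (α / 2) Ω u ≤
        ENNReal.ofReal C * eLpNorm (energyTransform κ₁ κ₂ α Ω u) 2 volume := by
  obtain ⟨m, hm0, hm⟩ := exists_le_rieszSymbol hκ₁ hκ₂ hα₁ hα₂
  refine ⟨(√m)⁻¹, fun Ω u => eLpNorm_le_mul_eLpNorm_of_ae_le_mul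
    (Eventually.of_forall fun ξ => ?_) 2⟩
  have h1 : ‖ξ‖ ^ (α / 2) ≤ (√m)⁻¹ * √(rieszSymbol κ₁ κ₂ α ξ) := by
    rw [inv_mul_eq_div, le_div_iff₀ (Real.sqrt_pos.2 hm0)]
    refine le_trans (le_of_eq ?_) (Real.sqrt_le_sqrt (hm ξ))
    rw [Real.sqrt_mul hm0.le, Real.sqrt_eq_rpow (‖ξ‖ ^ α), ← Real.rpow_mul (norm_nonneg _)]
    ring_nf
  rw [energyTransform, norm_mul, norm_mul, Complex.norm_real, Complex.norm_real,
    Real.norm_of_nonneg (Real.sqrt_nonneg _), Real.norm_of_nonneg (by positivity), ← mul_assoc]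
  gcongr

/-- The Poincaré–Friedrichs inequality for test functions, on the Fourier side. -/
theorem exists_poincare (hΩ : MeasurableSet Ω) (hκ₁ : 0 < κ₁) (hκ₂ : 0 < κ₂)
    (hα₁ : 1 < α) (hα₂ : α < 2) (K : ℝ)
    (hK : ∀ φ, IsTest Ω φ → ∀ ξ, ‖fourierZeroExt Ω φ ξ‖ ^ 2 ≤ K * ∫ z in Ω, φ z ^ 2) :
    ∃ C : ℝ, 0 ≤ C ∧ ∀ φ, IsTest Ω φ →
      ∫ z in Ω, φ z ^ 2 ≤ C * ∫ ξ, rieszSymbol κ₁ κ₂ α ξ * ‖fourierZeroExt Ω φ ξ‖ ^ 2 := by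
  obtain ⟨m, hm0, hm⟩ := exists_le_rieszSymbol hκ₁ hκ₂ hα₁ hα₂
  set k := Real.pi * |K| with hk
  have hk0 : 0 ≤ k := by positivity
  -- By `hK`, the ball of radius r, of area πr², carries at most r²k P of the squared norm. This
  -- choice makes that at most P/2, and the +1 keeps r well defined when K = 0.
  set r := (√(2 * (k + 1)))⁻¹ with hr
  have hr0 : 0 < r := by positivity
  have hrk : r ^ 2 * k ≤ 1 / 2 := by
    rw [hr, inv_pow, Real.sq_sqrt (by positivity), inv_mul_le_iff₀ (by positivity)]
    linarith
  have hmr : 0 < m * r ^ α := by positivity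
  refine ⟨2 * (m * r ^ α)⁻¹, by positivity, fun φ hφ => ?_⟩
  set P := ∫ z in Ω, φ z ^ 2 with hP
  have hP0 : 0 ≤ P := setIntegral_nonneg hΩ fun z _ => sq_nonneg _
  set Q := ∫ ξ, rieszSymbol κ₁ κ₂ α ξ * ‖fourierZeroExt Ω φ ξ‖ ^ 2 with hQ
  have hPF : P = ∫ ξ, ‖fourierZeroExt Ω φ ξ‖ ^ 2 := by
    rw [hφ.fourierZeroExt_eq, SchwartzMap.integral_norm_sq_fourier, hP,
      setIntegral_eq_integral_of_forall_compl_eq_zero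
        (fun z hz => by rw [hφ.eq_zero hz]; norm_num),
      ← measurePreserving_toPlane.integral_comp measurableEmbedding_toPlane]
    simp [IsTest.euclid_apply]
  have hint : Integrable fun ξ => ‖fourierZeroExt Ω φ ξ‖ ^ 2 := by
    rw [hφ.fourierZeroExt_eq]
    exact (memLp_two_iff_integrable_sq_norm
      (𝓕 hφ.euclid).continuous.aestronglyMeasurable).1 ((𝓕 hφ.euclid).memLp 2 volume)
  have hintQ : Integrable fun ξ => rieszSymbol κ₁ κ₂ α ξ * ‖fourierZeroExt Ω φ ξ‖ ^ 2 := by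
    simpa only [real_inner_self_eq_norm_sq] using integrable_rieszSymbol_mul hα₁ hα₂ κ₁ κ₂ hφ hφ
  have hlow : ∫ ξ in Metric.ball (0 : EuclideanSpace ℝ (Fin 2)) r,
      ‖fourierZeroExt Ω φ ξ‖ ^ 2 ≤ 1 / 2 * P := by
    have hvol : volume.real (Metric.ball (0 : EuclideanSpace ℝ (Fin 2)) r) = r ^ 2 * Real.pi := by
      rw [Measure.real, EuclideanSpace.volume_ball_fin_two, ENNReal.toReal_mul,
        ENNReal.toReal_pow, ENNReal.toReal_ofReal hr0.le]
      simp [Real.pi_nonneg]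
    have h1 : ∫ ξ in Metric.ball (0 : EuclideanSpace ℝ (Fin 2)) r,
        ‖fourierZeroExt Ω φ ξ‖ ^ 2 ≤
        ∫ ξ in Metric.ball (0 : EuclideanSpace ℝ (Fin 2)) r, |K| * P := by
      refine setIntegral_mono_on hint.integrableOn
        (integrableOn_const measure_ball_lt_top.ne) Metric.isOpen_ball.measurableSet
        fun ξ _ => ?_
      exact (hK φ hφ ξ).trans (mul_le_mul_of_nonneg_right (le_abs_self K) hP0)
    rw [setIntegral_const, hvol, smul_eq_mul] at h1
    calc _ ≤ _ := h1
      _ = (r ^ 2 * k) * P := by rw [hk]; ring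
      _ ≤ _ := by gcongr
  -- Outside the ball the symbol is at least m r^α. Then P ≤ P/2 + (m r^α)⁻¹ Q, and absorbing P/2
  -- gives the constant 2 (m r^α)⁻¹.
  have hhigh : ∫ ξ in (Metric.ball (0 : EuclideanSpace ℝ (Fin 2)) r)ᶜ,
      ‖fourierZeroExt Ω φ ξ‖ ^ 2 ≤ (m * r ^ α)⁻¹ * Q := by
    have h1 : ∫ ξ in (Metric.ball (0 : EuclideanSpace ℝ (Fin 2)) r)ᶜ,
        ‖fourierZeroExt Ω φ ξ‖ ^ 2 ≤
        ∫ ξ in (Metric.ball (0 : EuclideanSpace ℝ (Fin 2)) r)ᶜ,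
          (m * r ^ α)⁻¹ * (rieszSymbol κ₁ κ₂ α ξ * ‖fourierZeroExt Ω φ ξ‖ ^ 2) := by
      refine setIntegral_mono_on hint.integrableOn (hintQ.const_mul _).integrableOn
        Metric.isOpen_ball.measurableSet.compl fun ξ hξ => ?_
      have hξ' : r ≤ ‖ξ‖ := by simpa using hξ
      rw [← mul_assoc]
      refine le_mul_of_one_le_left (sq_nonneg _) ?_
      rw [inv_mul_eq_div, one_le_div hmr]
      refine le_trans ?_ (hm ξ)
      gcongr
    refine h1.trans ?_
    rw [integral_const_mul]
    gcongr
    refine setIntegral_le_integral hintQ (Eventually.of_forall fun ξ => ?_)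
    exact mul_nonneg (rieszSymbol_nonneg hκ₁ hκ₂ hα₁ hα₂ ξ) (sq_nonneg _)
  have hsum := integral_add_compl
    (Metric.isOpen_ball (x := (0 : EuclideanSpace ℝ (Fin 2))) (ε := r)).measurableSet hint
  rw [← hPF] at hsum
  linarith

end EnergySpace

/-! ### Auxiliary facts on L² -/

section L2Lemmas

variable {X F : Type*} [MeasurableSpace X] {μ : Measure X} [NormedAddCommGroup F]

theorem inner_toLp [InnerProductSpace ℝ F] {u v : X → F} (hu : MemLp u 2 μ) (hv : MemLp v 2 μ) :
    inner ℝ (hu.toLp u) (hv.toLp v) = ∫ x, inner ℝ (u x) (v x) ∂μ := by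
  rw [L2.inner_def]
  refine integral_congr_ae ?_
  filter_upwards [hu.coeFn_toLp, hv.coeFn_toLp] with x h1 h2
  rw [h1, h2]

theorem integral_norm_le_eLpNorm_two [IsFiniteMeasure μ] {u : X → F} (hu : MemLp u 2 μ) :
    ∫ x, ‖u x‖ ∂μ ≤ (μ univ ^ (1 / 2 : ℝ)).toReal * (eLpNorm u 2 μ).toReal := by
  rw [integral_norm_eq_lintegral_enorm hu.aestronglyMeasurable, ← eLpNorm_one_eq_lintegral_enorm,
    ← ENNReal.toReal_mul]
  have h := eLpNorm_le_eLpNorm_mul_rpow_measure_univ (μ := μ) (p := 1) (q := 2) (by norm_num)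
    hu.aestronglyMeasurable
  norm_num at h
  refine ENNReal.toReal_mono (ENNReal.mul_ne_top ?_ hu.eLpNorm_ne_top) ?_
  · exact ENNReal.rpow_ne_top_of_nonneg (by norm_num) (measure_ne_top _ _)
  · rw [mul_comm]; exact h

end L2Lemmas

/-! ### The concrete weak problem as an instance of the abstract one -/

section Energy

variable {a b c d κ₁ κ₂ α : ℝ}

theorem measurableSet_rect : MeasurableSet (rect a b c d) :=
  measurableSet_Ioo.prod measurableSet_Ioo

instance : IsFiniteMeasure ((volume : Measure (ℝ × ℝ)).restrict (rect a b c d)) := by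
  rw [volume_restrict_rect]
  infer_instance

/-- The inclusion of test functions into `L²`. -/
noncomputable def testToL2 (a b c d : ℝ) : testSpace (rect a b c d) →ₗ[ℝ] L2 a b c d where
  toFun φ := MemLp.toLp φ.1 (IsTest.memLp φ.2 2 _)
  map_add' φ ψ := MemLp.toLp_add (IsTest.memLp φ.2 2 _) (IsTest.memLp ψ.2 2 _)
  map_smul' r φ := MemLp.toLp_const_smul r (IsTest.memLp φ.2 2 _)

theorem testToL2_apply (φ : testSpace (rect a b c d)) :
    testToL2 a b c d φ = MemLp.toLp φ.1 (IsTest.memLp φ.2 2 _) := rfl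

theorem coeFn_testToL2 (φ : testSpace (rect a b c d)) :
    testToL2 a b c d φ =ᵐ[(volume : Measure (ℝ × ℝ)).restrict (rect a b c d)] φ.1 :=
  MemLp.coeFn_toLp (IsTest.memLp φ.2 2 _)

/-- The energy transform as a linear map from test functions into `L²`. -/
noncomputable def energyMap (a b c d : ℝ) (hκ₁ : 0 < κ₁) (hκ₂ : 0 < κ₂) (hα₁ : 1 < α)
    (hα₂ : α < 2) : testSpace (rect a b c d) →ₗ[ℝ]
      Lp ℂ 2 (volume : Measure (EuclideanSpace ℝ (Fin 2))) where
  toFun φ := MemLp.toLp (energyTransform κ₁ κ₂ α (rect a b c d) φ.1)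
    (IsTest.memLp_energyTransform φ.2 measurableSet_rect hκ₁ hκ₂ hα₁ hα₂)
  map_add' φ ψ := by
    rw [← MemLp.toLp_add]
    refine MemLp.toLp_congr _ _ (Eventually.of_forall fun ξ => ?_)
    have := fourierZeroExt_add measurableSet_rect (IsTest.integrableOn φ.2)
      (IsTest.integrableOn ψ.2)
    simp only [energyTransform, Submodule.coe_add, this, Pi.add_apply]
    ring
  map_smul' r φ := by
    simp only [RingHom.id_apply]
    rw [← MemLp.toLp_const_smul]
    refine MemLp.toLp_congr _ _ (Eventually.of_forall fun ξ => ?_)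
    simp only [energyTransform, Submodule.coe_smul, fourierZeroExt_smul, Pi.smul_apply,
      Complex.real_smul]
    ring

theorem energyMap_apply (hκ₁ : 0 < κ₁) (hκ₂ : 0 < κ₂) (hα₁ : 1 < α) (hα₂ : α < 2)
    (φ : testSpace (rect a b c d)) : energyMap a b c d hκ₁ hκ₂ hα₁ hα₂ φ =
      MemLp.toLp (energyTransform κ₁ κ₂ α (rect a b c d) φ.1)
        (IsTest.memLp_energyTransform φ.2 measurableSet_rect hκ₁ hκ₂ hα₁ hα₂) := rfl

/-- The fractional operator on test functions, as an element of `L²`. -/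
noncomputable def rieszOpL2 (a b c d κ₁ κ₂ : ℝ) (hα₁ : 1 < α) (hα₂ : α < 2)
    (φ : testSpace (rect a b c d)) : L2 a b c d :=
  MemLp.toLp (rieszOp κ₁ κ₂ α φ.1) (IsTest.memLp_rieszOp φ.2 κ₁ κ₂ hα₁ hα₂ _)

theorem inner_testToL2_rieszOpL2 (hκ₁ : 0 < κ₁) (hκ₂ : 0 < κ₂) (hα₁ : 1 < α) (hα₂ : α < 2)
    (ψ φ : testSpace (rect a b c d)) :
    inner ℝ (testToL2 a b c d ψ) (rieszOpL2 a b c d κ₁ κ₂ hα₁ hα₂ φ) =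
      -inner ℝ (energyMap a b c d hκ₁ hκ₂ hα₁ hα₂ ψ) (energyMap a b c d hκ₁ hκ₂ hα₁ hα₂ φ) := by
  have h := integral_mul_rieszOp hα₁ hα₂ κ₁ κ₂ ψ.2 φ.2
  rw [testToL2_apply, rieszOpL2, energyMap_apply, energyMap_apply, inner_toLp, inner_toLp]
  simp only [inner_energyTransform hκ₁ hκ₂ hα₁ hα₂]
  rw [← h]
  refine integral_congr_ae (Eventually.of_forall fun z => ?_)
  simp [mul_comm]

theorem norm_testToL2_sq (φ : testSpace (rect a b c d)) :
    ‖testToL2 a b c d φ‖ ^ 2 = ∫ z in rect a b c d, φ.1 z ^ 2 := by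
  rw [← real_inner_self_eq_norm_sq, testToL2_apply, inner_toLp]
  refine integral_congr_ae (Eventually.of_forall fun z => ?_)
  simp

theorem norm_energyMap_sq (hκ₁ : 0 < κ₁) (hκ₂ : 0 < κ₂) (hα₁ : 1 < α) (hα₂ : α < 2)
    (φ : testSpace (rect a b c d)) :
    ‖energyMap a b c d hκ₁ hκ₂ hα₁ hα₂ φ‖ ^ 2 =
      ∫ ξ, rieszSymbol κ₁ κ₂ α ξ * ‖fourierZeroExt (rect a b c d) φ.1 ξ‖ ^ 2 := by
  rw [← real_inner_self_eq_norm_sq, energyMap_apply, inner_toLp]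
  simp only [inner_energyTransform hκ₁ hκ₂ hα₁ hα₂, real_inner_self_eq_norm_sq]

/-- Supplies `hC` of the abstract theorem. In the Poincaré inequality K is the area of Ω, because
|φ̂(ξ)| ≤ ‖φ‖_{L¹} ≤ |Ω|^(1/2) ‖φ‖_{L²}. -/
theorem exists_norm_testToL2_le (a b c d : ℝ) (hκ₁ : 0 < κ₁) (hκ₂ : 0 < κ₂) (hα₁ : 1 < α)
    (hα₂ : α < 2) : ∃ C, ∀ φ : testSpace (rect a b c d),
      ‖testToL2 a b c d φ‖ ≤ C * ‖energyMap a b c d hκ₁ hκ₂ hα₁ hα₂ φ‖ := by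
  set μ := (volume : Measure (ℝ × ℝ)).restrict (rect a b c d)
  obtain ⟨C, hC0, hC⟩ := exists_poincare (κ₁ := κ₁) (κ₂ := κ₂) (α := α)
    (measurableSet_rect (a := a) (b := b) (c := c) (d := d)) hκ₁ hκ₂ hα₁ hα₂
    ((μ univ ^ (1 / 2 : ℝ)).toReal ^ 2) (by
      intro φ hφ ξ
      have h1 := norm_fourierZeroExt_le measurableSet_rect φ ξ (Ω := rect a b c d)
      have h2 := integral_norm_le_eLpNorm_two (hφ.memLp 2 μ)
      have h3 := norm_testToL2_sq (⟨φ, hφ⟩ : testSpace (rect a b c d))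
      rw [← h3, ← mul_pow]
      have h4 : ‖testToL2 a b c d ⟨φ, hφ⟩‖ = (eLpNorm φ 2 μ).toReal :=
        Lp.norm_toLp _ (hφ.memLp 2 μ)
      rw [h4]
      gcongr
      exact h1.trans h2)
  refine ⟨√C, fun φ => abs_le_of_sq_le_sq' ?_ (by positivity) |>.2⟩
  rw [mul_pow, Real.sq_sqrt hC0, norm_testToL2_sq, norm_energyMap_sq]
  exact hC φ.1 φ.2

theorem L2.memLp (u : L2 a b c d) :
    MemLp u 2 ((volume : Measure (ℝ × ℝ)).restrict (rect a b c d)) := Lp.memLp u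

theorem L2.integrableOn (u : L2 a b c d) : IntegrableOn u (rect a b c d) :=
  (Lp.memLp u).integrable (by norm_num)

theorem enorm_sub_testToL2 (w : L2 a b c d) (φ : testSpace (rect a b c d)) :
    ‖w - testToL2 a b c d φ‖ₑ =
      eLpNorm (⇑w - φ.1) 2 ((volume : Measure (ℝ × ℝ)).restrict (rect a b c d)) := by
  rw [Lp.enorm_def]
  refine eLpNorm_congr_ae ?_
  filter_upwards [Lp.coeFn_sub w (testToL2 a b c d φ), coeFn_testToL2 φ]
    with z h1 h2
  rw [h1, Pi.sub_apply, Pi.sub_apply, h2]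

theorem energyTransform_sub (w : L2 a b c d) (φ : testSpace (rect a b c d)) :
    energyTransform κ₁ κ₂ α (rect a b c d) (⇑w - φ.1) =
      energyTransform κ₁ κ₂ α (rect a b c d) w - energyTransform κ₁ κ₂ α (rect a b c d) φ.1 := by
  ext ξ
  simp only [energyTransform, fourierZeroExt_sub measurableSet_rect (L2.integrableOn w)
    (IsTest.integrableOn φ.2), Pi.sub_apply]
  ring

/-- On a set of finite measure L² convergence implies L¹ convergence, hence convergence of the
transforms at every frequency. -/
theorem tendsto_fourierZeroExt {w : L2 a b c d} {φ : ℕ → testSpace (rect a b c d)}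
    (h : Tendsto (fun n => testToL2 a b c d (φ n)) atTop (𝓝 w))
    (ξ : EuclideanSpace ℝ (Fin 2)) :
    Tendsto (fun n => fourierZeroExt (rect a b c d) (φ n).1 ξ) atTop
      (𝓝 (fourierZeroExt (rect a b c d) w ξ)) := by
  set μ := (volume : Measure (ℝ × ℝ)).restrict (rect a b c d)
  have h0 : Tendsto (fun n => ‖w - testToL2 a b c d (φ n)‖) atTop (𝓝 0) := by
    simpa using (tendsto_const_nhds (x := w) |>.sub h).norm
  rw [tendsto_iff_norm_sub_tendsto_zero]
  have h1 := h0.const_mul (μ univ ^ (1 / 2 : ℝ)).toReal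
  rw [mul_zero] at h1
  refine squeeze_zero (fun _ => norm_nonneg _) (fun n => ?_) h1
  have h2 := norm_fourierZeroExt_le measurableSet_rect (⇑w - (φ n).1) ξ (Ω := rect a b c d)
  rw [fourierZeroExt_sub measurableSet_rect (L2.integrableOn w) (IsTest.integrableOn (φ n).2),
    Pi.sub_apply, norm_sub_rev] at h2
  refine h2.trans ?_
  have h3 := integral_norm_le_eLpNorm_two ((L2.memLp w).sub (IsTest.memLp (φ n).2 2 μ))
  rwa [← enorm_sub_testToL2, toReal_enorm] at h3

theorem MemH0.inClosure (hκ₁ : 0 < κ₁) (hκ₂ : 0 < κ₂) (hα₁ : 1 < α) (hα₂ : α < 2)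
    {w : L2 a b c d} (hw : MemH0 (α / 2) (rect a b c d) w) :
    InClosure (testToL2 a b c d) (energyMap a b c d hκ₁ hκ₂ hα₁ hα₂) w := by
  obtain ⟨φ, hφ, hlim⟩ := hw
  obtain ⟨C, hC⟩ := exists_energyTransform_le hκ₁ hκ₂ hα₁ hα₂
  let Φ : ℕ → testSpace (rect a b c d) := fun n => ⟨φ n, hφ n⟩
  have root : ∀ s t : ℝ≥0∞, s ≤ (s ^ 2 + t ^ 2) ^ (1 / 2 : ℝ) := fun s t => by
    calc s = (s ^ 2) ^ (1 / 2 : ℝ) := by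
          rw [← ENNReal.rpow_natCast, ← ENNReal.rpow_mul]; norm_num
      _ ≤ _ := ENNReal.rpow_le_rpow le_self_add (by norm_num)
  have h1 : Tendsto (fun n => ‖w - testToL2 a b c d (Φ n)‖ₑ) atTop (𝓝 0) := by
    refine tendsto_of_tendsto_of_tendsto_of_le_of_le tendsto_const_nhds hlim
      (fun _ => zero_le) fun n => ?_
    rw [enorm_sub_testToL2]
    exact root _ _
  have h2 : Tendsto (fun n => sobolevSeminorm (α / 2) (rect a b c d) (⇑w - φ n)) atTop (𝓝 0) := by
    refine tendsto_of_tendsto_of_tendsto_of_le_of_le tendsto_const_nhds hlim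
      (fun _ => zero_le) fun n => ?_
    rw [sobolevNorm, add_comm]
    exact root _ _
  have h3 : Tendsto (fun n => eLpNorm (energyTransform κ₁ κ₂ α (rect a b c d) (⇑w - φ n)) 2 volume)
      atTop (𝓝 0) := by
    have h4 := ENNReal.Tendsto.const_mul (a := ENNReal.ofReal C) h2 (Or.inr ENNReal.ofReal_ne_top)
    rw [mul_zero] at h4
    exact tendsto_of_tendsto_of_tendsto_of_le_of_le tendsto_const_nhds h4
      (fun _ => zero_le) fun n => hC _ _
  -- Some difference w - φ n has finite energy, and so has φ n itself.
  have hmem : MemLp (energyTransform κ₁ κ₂ α (rect a b c d) w) 2 volume := by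
    obtain ⟨n, hn⟩ := (h3.eventually (gt_mem_nhds ENNReal.zero_lt_top)).exists
    have hd : MemLp (energyTransform κ₁ κ₂ α (rect a b c d) (⇑w - φ n)) 2 volume :=
      ⟨aestronglyMeasurable_energyTransform measurableSet_rect
        ((L2.integrableOn w).sub (hφ n).integrableOn), hn⟩
    have := hd.add ((hφ n).memLp_energyTransform measurableSet_rect hκ₁ hκ₂ hα₁ hα₂)
    rwa [energyTransform_sub w (Φ n), sub_add_cancel] at this
  refine ⟨Φ, hmem.toLp _, ?_, ?_⟩
  · rw [tendsto_iff_edist_tendsto_0]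
    simpa only [edist_comm _ w, edist_eq_enorm_sub] using h1
  · rw [tendsto_iff_edist_tendsto_0]
    refine h3.congr fun n => ?_
    rw [edist_comm, edist_eq_enorm_sub, energyTransform_sub w (Φ n)]
    rw [energyMap_apply, ← MemLp.toLp_sub, Lp.enorm_toLp]

theorem InClosure.memH0 (hκ₁ : 0 < κ₁) (hκ₂ : 0 < κ₂) (hα₁ : 1 < α) (hα₂ : α < 2)
    {w : L2 a b c d}
    (hw : InClosure (testToL2 a b c d) (energyMap a b c d hκ₁ hκ₂ hα₁ hα₂) w) :
    MemH0 (α / 2) (rect a b c d) w := by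
  obtain ⟨φ, U, h1, h2⟩ := hw
  obtain ⟨C, hC⟩ := exists_sobolevSeminorm_le hκ₁ hκ₂ hα₁ hα₂
  have hcoe : ∀ n, energyMap a b c d hκ₁ hκ₂ hα₁ hα₂ (φ n) =ᵐ[volume]
      energyTransform κ₁ κ₂ α (rect a b c d) (φ n).1 := fun n =>
    MemLp.coeFn_toLp (IsTest.memLp_energyTransform (φ n).2 measurableSet_rect hκ₁ hκ₂ hα₁ hα₂)
  -- A subsequence converges a.e. to `U`, while the transforms converge pointwise to that of `w`;
  -- the two limits agree.
  have hU : U =ᵐ[volume] energyTransform κ₁ κ₂ α (rect a b c d) w := by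
    obtain ⟨ns, hns, hae⟩ := (tendstoInMeasure_of_tendsto_Lp h2).exists_seq_tendsto_ae
    filter_upwards [hae, ae_all_iff.2 hcoe] with ξ hξ hξ2
    refine tendsto_nhds_unique hξ ?_
    have h3 := ((tendsto_fourierZeroExt h1 ξ).comp hns.tendsto_atTop).const_mul
      ((√(rieszSymbol κ₁ κ₂ α ξ) : ℝ) : ℂ)
    refine h3.congr fun n => ?_
    rw [hξ2]
    rfl
  have h3 : Tendsto (fun n => sobolevSeminorm (α / 2) (rect a b c d) (⇑w - (φ n).1))
      atTop (𝓝 0) := by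
    have h4 : Tendsto (fun n => ‖U - energyMap a b c d hκ₁ hκ₂ hα₁ hα₂ (φ n)‖ₑ) atTop (𝓝 0) := by
      simpa only [edist_comm _ U, edist_eq_enorm_sub] using tendsto_iff_edist_tendsto_0.1 h2
    have h5 := ENNReal.Tendsto.const_mul (a := ENNReal.ofReal C) h4 (Or.inr ENNReal.ofReal_ne_top)
    rw [mul_zero] at h5
    refine tendsto_of_tendsto_of_tendsto_of_le_of_le tendsto_const_nhds h5
      (fun _ => zero_le) fun n => (hC _ _).trans_eq ?_
    congr 1
    rw [Lp.enorm_def]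
    refine eLpNorm_congr_ae ?_
    rw [energyTransform_sub]
    filter_upwards [Lp.coeFn_sub U (energyMap a b c d hκ₁ hκ₂ hα₁ hα₂ (φ n)), hU, hcoe n]
      with ξ e1 e2 e3
    rw [e1, Pi.sub_apply, Pi.sub_apply, e2, e3]
  have h4 : Tendsto (fun n => eLpNorm (⇑w - (φ n).1) 2
      ((volume : Measure (ℝ × ℝ)).restrict (rect a b c d))) atTop (𝓝 0) := by
    simp only [← enorm_sub_testToL2]
    simpa only [edist_comm _ w, edist_eq_enorm_sub] using tendsto_iff_edist_tendsto_0.1 h1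
  refine ⟨fun n => (φ n).1, fun n => (φ n).2, ?_⟩
  have h5 := ((ENNReal.Tendsto.pow (n := 2) h4).add (ENNReal.Tendsto.pow (n := 2) h3)).ennrpow_const
    (1 / 2 : ℝ)
  simpa [sobolevNorm] using h5

/-- The dictionary that lets `exists_solution_operator` apply: the Sobolev closure is the energy
closure, and the distributional equation is the pairing of `w` with the operator on test functions.
-/
theorem isSolution_iff (hκ₁ : 0 < κ₁) (hκ₂ : 0 < κ₂) (hα₁ : 1 < α) (hα₂ : α < 2)
    (f w : L2 a b c d) :
    IsSolution κ₁ κ₂ α a b c d f w ↔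
      InClosure (testToL2 a b c d) (energyMap a b c d hκ₁ hκ₂ hα₁ hα₂) w ∧
        ∀ φ, inner ℝ w (rieszOpL2 a b c d κ₁ κ₂ hα₁ hα₂ φ) = inner ℝ f (testToL2 a b c d φ) := by
  have hl : ∀ φ : testSpace (rect a b c d),
      inner ℝ w (rieszOpL2 a b c d κ₁ κ₂ hα₁ hα₂ φ) =
        κ₁ * rieszX α a b c d w φ.1 + κ₂ * rieszY α a b c d w φ.1 := by
    intro φ
    rw [weak_form_eq hα₁ hα₂ κ₁ κ₂ (L2.integrableOn w) φ.2, L2.inner_def]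
    refine integral_congr_ae ?_
    have h : rieszOpL2 a b c d κ₁ κ₂ hα₁ hα₂ φ
        =ᵐ[(volume : Measure (ℝ × ℝ)).restrict (rect a b c d)] rieszOp κ₁ κ₂ α φ.1 :=
      MemLp.coeFn_toLp (IsTest.memLp_rieszOp φ.2 κ₁ κ₂ hα₁ hα₂ _)
    filter_upwards [h] with z hz
    rw [hz]
    simp [mul_comm]
  have hr : ∀ φ : testSpace (rect a b c d), inner ℝ f (testToL2 a b c d φ) =
        ∫ z in rect a b c d, f z * φ.1 z := by
    intro φ
    rw [L2.inner_def]
    refine integral_congr_ae ?_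
    filter_upwards [coeFn_testToL2 φ] with z hz
    rw [hz]
    simp [mul_comm]
  constructor
  · rintro ⟨h1, h2⟩
    exact ⟨h1.inClosure hκ₁ hκ₂ hα₁ hα₂, fun φ => by rw [hl, hr]; exact h2 φ.1 φ.2⟩
  · rintro ⟨h1, h2⟩
    refine ⟨h1.memH0 hκ₁ hκ₂ hα₁ hα₂, fun φ hφ => ?_⟩
    have := h2 ⟨φ, hφ⟩
    rwa [hl, hr] at this

end Energy

/-! ### The admissible set -/

section Admissible

variable {a b c d v₁ v₂ : ℝ}

/-- As an order interval of the lattice L², the set is closed because the order is. -/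
theorem admissible_eq_Icc : admissible a b c d v₁ v₂ =
    Icc (Lp.const 2 ((volume : Measure (ℝ × ℝ)).restrict (rect a b c d)) v₁)
      (Lp.const 2 ((volume : Measure (ℝ × ℝ)).restrict (rect a b c d)) v₂) := by
  ext q
  simp only [admissible, mem_ofPred_eq, mem_Icc, ← Lp.coeFn_le]
  have h1 := Lp.coeFn_const (p := 2) (μ := (volume : Measure (ℝ × ℝ)).restrict (rect a b c d)) v₁
  have h2 := Lp.coeFn_const (p := 2) (μ := (volume : Measure (ℝ × ℝ)).restrict (rect a b c d)) v₂
  constructor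
  · intro h
    constructor
    · filter_upwards [h, h1] with z hz hz1
      rw [hz1]; exact hz.1
    · filter_upwards [h, h2] with z hz hz2
      rw [hz2]; exact hz.2
  · rintro ⟨h3, h4⟩
    filter_upwards [h1, h2, h3, h4] with z e1 e2 e3 e4
    rw [e1] at e3
    rw [e2] at e4
    exact ⟨e3, e4⟩

theorem isClosed_admissible : IsClosed (admissible a b c d v₁ v₂) := by
  rw [admissible_eq_Icc]
  exact isClosed_Icc

theorem convex_admissible : Convex ℝ (admissible a b c d v₁ v₂) := by
  intro p hp q hq s t hs ht hst
  filter_upwards [hp, hq, Lp.coeFn_add (s • p) (t • q), Lp.coeFn_smul s p, Lp.coeFn_smul t q]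
    with z h1 h2 e1 e2 e3
  rw [e1, Pi.add_apply, e2, e3]
  exact convex_Icc v₁ v₂ h1 h2 hs ht hst

theorem admissible_nonempty (hv : v₁ ≤ v₂) : (admissible a b c d v₁ v₂).Nonempty := by
  refine ⟨Lp.const 2 _ v₁, ?_⟩
  filter_upwards [Lp.coeFn_const (p := 2)
    (μ := (volume : Measure (ℝ × ℝ)).restrict (rect a b c d)) v₁] with z hz
  rw [hz]
  exact ⟨le_rfl, hv⟩

theorem inner_smul_add_sub (γ : ℝ) (q p δ : L2 a b c d) :
    inner ℝ (γ • q + p) (δ - q) = ∫ z in rect a b c d, (γ * q z + p z) * (δ z - q z) := by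
  rw [L2.inner_def]
  refine integral_congr_ae ?_
  filter_upwards [Lp.coeFn_add (γ • q) p, Lp.coeFn_smul γ q, Lp.coeFn_sub δ q] with z e1 e2 e3
  rw [e1, e3, Pi.add_apply, e2]
  simp [mul_comm]

end Admissible

end RieszOCP

/-! ### Existence, uniqueness and optimality conditions -/

theorem theorem2p1 (a b c d κ₁ κ₂ γ α v₁ v₂ : ℝ) (hab : a < b) (hcd : c < d)
    (hκ₁ : 0 < κ₁) (hκ₂ : 0 < κ₂) (hγ : 0 < γ) (hα₁ : 1 < α) (hα₂ : α < 2) (hv : v₁ ≤ v₂)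
    (g ud : RieszOCP.L2 a b c d) :
    ∃ q u : RieszOCP.L2 a b c d,
      RieszOCP.IsOptimal κ₁ κ₂ γ α a b c d v₁ v₂ g ud q u ∧
      (∀ q' u' : RieszOCP.L2 a b c d,
        RieszOCP.IsOptimal κ₁ κ₂ γ α a b c d v₁ v₂ g ud q' u' → q' = q ∧ u' = u) ∧
      ∃ p : RieszOCP.L2 a b c d,
        RieszOCP.IsSolution κ₁ κ₂ α a b c d (g + q) u ∧
        RieszOCP.IsSolution κ₁ κ₂ α a b c d (u - ud) p ∧
        ∀ δq ∈ RieszOCP.admissible a b c d v₁ v₂,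
          0 ≤ ∫ z in RieszOCP.rect a b c d, (γ * q z + p z) * (δq z - q z) := by
  obtain ⟨C, hC⟩ := RieszOCP.exists_norm_testToL2_le a b c d hκ₁ hκ₂ hα₁ hα₂
  obtain ⟨S, hS, hsol⟩ := RieszOCP.exists_solution_operator _ _
    (RieszOCP.rieszOpL2 a b c d κ₁ κ₂ hα₁ hα₂) C hC
    (RieszOCP.inner_testToL2_rieszOpL2 hκ₁ hκ₂ hα₁ hα₂)
  have hS' : ∀ f w, RieszOCP.IsSolution κ₁ κ₂ α a b c d f w ↔ w = S f := fun f w =>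
    (RieszOCP.isSolution_iff hκ₁ hκ₂ hα₁ hα₂ f w).trans (hsol f w)
  obtain ⟨q, hq, hmin, huniq, hvar⟩ := RieszOCP.exists_unique_optimal_control S hS
    (RieszOCP.admissible_nonempty hv) RieszOCP.isClosed_admissible
    RieszOCP.convex_admissible hγ g ud
  have hu := (hS' (g + q) (S (g + q))).2 rfl
  -- The costate is S(u - ud): the adjoint equation uses the same operator because `S` is
  -- self-adjoint.
  refine ⟨q, S (g + q), ⟨⟨hq, hu⟩, ?_⟩, ?_, S (S (g + q) - ud), hu, (hS' _ _).2 rfl, ?_⟩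
  · rintro q' u' ⟨hq', hu'⟩
    rw [(hS' _ _).1 hu']
    exact hmin q' hq'
  · rintro q' u' ⟨⟨hq', hu'⟩, hopt⟩
    have hle := hopt q (S (g + q)) ⟨hq, hu⟩
    rw [(hS' _ _).1 hu'] at hle ⊢
    have := huniq q' hq' hle
    exact ⟨this, by rw [this]⟩
  · intro δq hδ
    rw [← RieszOCP.inner_smul_add_sub]
    exact hvar δq hδ
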